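/- **Conventions.** A map $f\colon B\to A$ of a category is *powerful* if pullback $f^*$ along it exists and has a right adjoint, the dependent product $\Pi_B$ along $f$. For an object $c$ of a category $\mathbf C$, $(c/\mathbf C)^\circ$ is the full subcategory of the under category $c/\mathbf C$ on all objects except $\mathrm{id}_c$, and for $X\colon\mathbf C\to\mathcal E$ we put $\overline M_cX=\lim_{(c\to d)\in(c/\mathbf C)^\circ}X(d)$. The *collage* $[H]$ of $H\colon\mathcal C^{\mathrm{op}}\times\mathcal D\to\mathbf{Set}$ is the category whose objects are those of $\mathcal C\sqcup\mathcal D$, whose maps are those of $\mathcal C$ and of $\mathcal D$ and the elements of $H(c,d)$ as maps $c\to d$, with no maps $d\to c$. A *strict inverse category* is a small category $\mathcal N$ with $\deg\colon\mathrm{ob}\,\mathcal N\to\mathbb N$ such that maps that are not isomorphisms strictly lower the degree, isomorphisms preserve it, and every isomorphism is an identity. An *iterated gluing diagram* consists of a strict inverse category $\mathcal N$, a diagram of small categories $\mathcal I\colon\mathcal N^{\mathrm{op}}\to\mathbf{Cat}$, small categories $\partial\mathcal I_n$ for $n\in\mathcal N$, and functors $\mathcal I_n^\circ\colon(\partial\mathcal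 I_n)^{\mathrm{op}}\times\mathcal I_{<n}\to\mathbf{Set}$, where $\mathcal I_{<n}$ is the colimit in $\mathbf{Cat}$ of the $\mathcal I_m$ weighted by the non-identity maps $n\to m$, such that $\mathcal I_n=[\mathcal I_n^\circ]$ and, for each non-identity $\alpha\colon n\to m$, the functor $\mathcal I_\alpha\colon\mathcal I_m\to\mathcal I_n$ is the colimit leg $\mathcal I_m\to\mathcal I_{<n}$ followed by the inclusion $\mathcal I_{<n}\hookrightarrow\mathcal I_n$. Put $\mathcal I_\infty=\operatorname{colim}_n\mathcal I_n$ and write $[i]_n\in\mathcal I_\infty$ for the image of $i\in\partial\mathcal I_n$. For $i\in\partial\mathcal I_n$ let $i/\mathcal I_{<n}$ be the category of elements of $\mathcal I_n^\circ(i,-)$, and for $X\colon\mathcal I_{<n}\to\mathcal E$ let $M_nX\colon\partial\mathcal I_n\to\mathcal E$ be the diagram $i\mapsto\lim_{(i\to j)\in i/\mathcal I_{<n}}X(j)$ (for diagrams on $\mathcal I_\infty$, restrict to $\mathcal I_{<n}$ first). **Theorem.** Let $\mathcal I_\infty$ be the iterated gluing category of such a diagram, $\mathcal W$ a class of maps of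 $\mathcal I_\infty$ (the weak equivalences), and $\gamma\colon\mathcal I_\infty\to\operatorname{Ho}\mathcal I_\infty=\mathcal W^{-1}\mathcal I_\infty$ the localisation, which is the identity on objects. Let $\mathcal E$ be a category with pullbacks. Assume that 1. $\mathcal E$ has limits indexed by $i/\mathcal I_{<n}$ and by $([i]_n/\operatorname{Ho}\mathcal I_\infty)^\circ$ for all $n\in\mathcal N$ and $i\in\partial\mathcal I_n$; 2. every map of $\operatorname{Ho}\mathcal I_\infty$ is an epimorphism; 3. for all $n\in\mathcal N$ and $i\in\partial\mathcal I_n$, $\gamma$ restricts to a functor $i/\mathcal I_{<n}\to([i]_n/\operatorname{Ho}\mathcal I_\infty)^\circ$, and this functor is initial. Let $f\colon B\to A$ be a map of $\mathcal E^{\operatorname{Ho}\mathcal I_\infty}$ such that for all $n\in\mathcal N$ and $i\in\partial\mathcal I_n$ the following maps are powerful: the restriction $f|_{=n}\colon B|_{=n}\to A|_{=n}$ in $\mathcal E^{\partial\mathcal I_n}$, the map $M_n(\gamma^*f)\colon M_n(\gamma^*B)\to M_n(\gamma^*A)$ in $\mathcal E^{\partial\mathcal I_n}$, the component $f_{[i]_n}\colon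 B[i]_n\to A[i]_n$ in $\mathcal E$, and $\overline M_{[i]_n}f\colon\overline M_{[i]_n}B\to\overline M_{[i]_n}A$ in $\mathcal E$. Then $f$ is powerful in $\mathcal E^{\operatorname{Ho}\mathcal I_\infty}$, $\gamma^*f$ is powerful in $\mathcal E^{\mathcal I_\infty}$, and the canonical comparison $$\varphi\colon\gamma^*(\Pi_B-)\longrightarrow\Pi_{\gamma^*B}\gamma^*(-)\;\colon\;\mathcal E^{\operatorname{Ho}\mathcal I_\infty}/B\rightrightarrows\mathcal E^{\mathcal I_\infty}/\gamma^*A$$ is a natural isomorphism. Here $\varphi_C$ is the map whose transpose under $(\gamma^*f)^*\dashv\Pi_{\gamma^*B}$ is $\gamma^*B\times_{\gamma^*A}\gamma^*(\Pi_BC)\cong\gamma^*(B\times_A\Pi_BC)\to\gamma^*C$, the last map being $\gamma^*$ of the counit (evaluation) of $f^*\dashv\Pi_B$. In particular $\gamma^*(\Pi_BC)\cong\Pi_{\gamma^*B}\gamma^*C$ over $\gamma^*A$ for every $C\to B$, so $\gamma^*$ preserves dependent products along $f$. -/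

import Mathlib

open CategoryTheory CategoryTheory.Limits Opposite

universe v u v₁ u₁ v₂ u₂

noncomputable section

namespace GluingPi

/-! ### Powerful maps and the comparison of dependent products -/

/-- A map is powerful if pullback along it exists and has a right adjoint. -/
def IsPowerful {C : Type u₁} [Category.{v₁} C] {B A : C} (f : B ⟶ A) : Prop :=
  ∃ _ : HasPullbacksAlong f, (Over.pullback f).IsLeftAdjoint

section Comparison

variable {C : Type u₁} [Category.{v₁} C] [HasPullbacks C]
  {D : Type u₂} [Category.{v₂} D] [HasPullbacks D]

theorem baseChange_naturality (G : C ⥤ D) [PreservesLimitsOfShape WalkingCospan G]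
    {B A X Y : C} (f : B ⟶ A) {x : X ⟶ A} {y : Y ⟶ A} (k : X ⟶ Y)
    (u : pullback (G.map x) (G.map f) ⟶ pullback (G.map y) (G.map f))
    (v : pullback x f ⟶ pullback y f)
    (hu : u ≫ pullback.fst _ _ = pullback.fst _ _ ≫ G.map k)
    (hu' : u ≫ pullback.snd _ _ = pullback.snd _ _)
    (hv : v ≫ pullback.fst _ _ = pullback.fst _ _ ≫ k)
    (hv' : v ≫ pullback.snd _ _ = pullback.snd _ _) :
    u ≫ (PreservesPullback.iso G y f).inv = (PreservesPullback.iso G x f).inv ≫ G.map v := by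
  rw [← cancel_mono (PreservesPullback.iso G y f).hom,
    ← cancel_epi (PreservesPullback.iso G x f).hom]
  simp only [Category.assoc, Iso.inv_hom_id, Iso.hom_inv_id_assoc, Category.comp_id]
  apply pullback.hom_ext
  · rw [Category.assoc, Category.assoc, hu, PreservesPullback.iso_hom,
      PreservesPullback.iso_hom, pullbackComparison_comp_fst, ← Category.assoc,
      pullbackComparison_comp_fst, ← G.map_comp, ← G.map_comp, hv]
  · rw [Category.assoc, Category.assoc, hu', PreservesPullback.iso_hom,
      PreservesPullback.iso_hom, pullbackComparison_comp_snd, pullbackComparison_comp_snd,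
      ← G.map_comp, hv']

/-- A pullback-preserving functor commutes with base change along `f : B ⟶ A`:
`G B ×_{G A} G X ≅ G (B ×_A X)`, over `G B` and naturally in `X` over `A`. -/
def baseChangeIso (G : C ⥤ D) [PreservesLimitsOfShape WalkingCospan G] {B A : C} (f : B ⟶ A) :
    Over.post G ⋙ Over.pullback (G.map f) ≅ Over.pullback f ⋙ Over.post G :=
  NatIso.ofComponents
    (fun X => Over.isoMk (PreservesPullback.iso G X.hom f).symm
      ((Iso.inv_comp_eq _).2 (pullbackComparison_comp_snd G X.hom f).symm))
    (fun k => Over.OverMorphism.ext (baseChange_naturality G f k.left _ _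
      (pullback.lift_fst _ _ _) (pullback.lift_snd _ _ _)
      (pullback.lift_fst _ _ _) (pullback.lift_snd _ _ _)))

/-- Let `G` preserve pullbacks, let `f : B ⟶ A`, and let `P` and `P'` be dependent product
functors (right adjoints of pullback) along `f` and `G f`.  The canonical comparison
`G (P X) ⟶ P' (G X)` over `G A`, natural in `X` over `B`, is the map whose transpose
under `(G f)^* ⊣ P'` is
`G B ×_{G A} G (P X) ≅ G (B ×_A P X) ⟶ G X`, the image under `G` of the evaluation (counit). -/
def piComparison (G : C ⥤ D) [PreservesLimitsOfShape WalkingCospan G] {B A : C} (f : B ⟶ A)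
    {P : Over B ⥤ Over A} (adj : Over.pullback f ⊣ P)
    {P' : Over (G.obj B) ⥤ Over (G.obj A)} (adj' : Over.pullback (G.map f) ⊣ P') :
    P ⋙ Over.post G ⟶ Over.post G ⋙ P' where
  app X := adj'.homEquiv _ _
    ((baseChangeIso G f).hom.app (P.obj X) ≫ (Over.post G).map (adj.counit.app X))
  naturality X Y k := by
    have h := (baseChangeIso G f).hom.naturality (P.map k)
    have h' := congrArg (Over.post G).map (adj.counit.naturality k)
    simp only [Functor.comp_map, Functor.map_comp, Functor.id_map] at h h'
    rw [Functor.comp_map, Functor.comp_map, ← adj'.homEquiv_naturality_left,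
      ← adj'.homEquiv_naturality_right]
    congr 1
    rw [Category.assoc, ← h', ← Category.assoc, ← Category.assoc, h]

end Comparison

/-! ### Local boundaries and their matching objects -/

section Boundary

variable {C : Type u₁} [Category.{v₁} C]

/-- `(c/C)°`: the full subcategory of the under category `c/C` on all objects but `𝟙 c`. -/
abbrev Boundary (c : C) : Type (max u₁ v₁) :=
  ObjectProperty.FullSubcategory (fun X : Under c => X ≠ Under.mk (𝟙 c))

/-- The projection `(c/C)° ⥤ C`. -/
abbrev Boundary.proj (c : C) : Boundary c ⥤ C :=
  ObjectProperty.ι _ ⋙ Under.forget c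

/-- The local matching object functor at `c`, sending `X : C ⥤ E` to the limit of `X` over
`(c/C)°`; this is the value at `𝟙 c` of the right Kan extension along `(c/C)° ⥤ c/C`. -/
def localMatching (c : C) (E : Type u₂) [Category.{v₂} E] [HasLimitsOfShape (Boundary c) E] :
    (C ⥤ E) ⥤ E :=
  (Functor.whiskeringLeft _ _ E).obj (Boundary.proj c) ⋙ lim

end Boundary

/-! ### Collages of profunctors and the associated matching functors -/

/-- The objects of the collage of `H` from `C` to `D`: those of `C` and those of `D`. -/
inductive Collage {C : Type u} [Category.{v} C] {D : Type u} [Category.{v} D]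
    (H : Cᵒᵖ ⥤ D ⥤ Type v) : Type u
  | inl : C → Collage H
  | inr : D → Collage H

namespace Collage

variable {C : Type u} [Category.{v} C] {D : Type u} [Category.{v} D] {H : Cᵒᵖ ⥤ D ⥤ Type v}

/-- Maps of the collage: those of `C`, those of `D`, the elements of `H(c, d)` as maps from
`c` to `d`, and no maps from `d` to `c`. -/
def Hom : Collage H → Collage H → Type v
  | inl c, inl c' => c ⟶ c'
  | inl c, inr d => (H.obj (op c)).obj d
  | inr _, inl _ => PEmpty
  | inr d, inr d' => d ⟶ d'

/-- Identities of the collage. -/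
def id : ∀ X : Collage H, Hom X X
  | inl c => 𝟙 c
  | inr d => 𝟙 d

/-- Composition in the collage, given by composition in `C` and `D` and functoriality of `H`. -/
def comp : ∀ {X Y Z : Collage H}, Hom X Y → Hom Y Z → Hom X Z
  | inl _, inl _, inl _, f, g => CategoryStruct.comp (obj := C) f g
  | inl _, inl _, inr d, f, x => (H.map (Quiver.Hom.op (V := C) f)).app d x
  | inl c, inr _, inr _, x, g => (H.obj (op c)).map g x
  | inr _, inr _, inr _, f, g => CategoryStruct.comp (obj := D) f g
  | inr _, inl _, _, f, _ => PEmpty.elim f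
  | _, inr _, inl _, _, g => PEmpty.elim g

theorem assoc₁ {c₁ c₂ c₃ : C} {d : D} (f : c₁ ⟶ c₂) (g : c₂ ⟶ c₃)
    (x : (H.obj (op c₃)).obj d) :
    (H.map (f ≫ g).op).app d x = (H.map f.op).app d ((H.map g.op).app d x) := by
  simp

theorem assoc₂ {c₁ c₂ : C} {d₁ d₂ : D} (f : c₁ ⟶ c₂) (x : (H.obj (op c₂)).obj d₁)
    (g : d₁ ⟶ d₂) :
    (H.obj (op c₁)).map g ((H.map f.op).app d₁ x) =
      (H.map f.op).app d₂ ((H.obj (op c₂)).map g x) := by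
  simp

theorem assoc₃ {c : C} {d₁ d₂ d₃ : D} (x : (H.obj (op c)).obj d₁) (g : d₁ ⟶ d₂)
    (h : d₂ ⟶ d₃) :
    (H.obj (op c)).map h ((H.obj (op c)).map g x) = (H.obj (op c)).map (g ≫ h) x := by
  simp

instance : Category.{v} (Collage H) where
  Hom := Hom
  id := id
  comp := comp
  id_comp {X Y} f := by
    cases X <;> cases Y
    · exact Category.id_comp (obj := C) f
    · simp [comp, id]; rfl
    · exact PEmpty.elim f
    · exact Category.id_comp (obj := D) f
  comp_id {X Y} f := by
    cases X <;> cases Y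
    · exact Category.comp_id (obj := C) f
    · simp [comp, id]; rfl
    · exact PEmpty.elim f
    · exact Category.comp_id (obj := D) f
  assoc {X Y Z T} f g h := by
    rcases X with c₁ | d₁ <;> rcases Y with c₂ | d₂ <;> rcases Z with c₃ | d₃ <;>
      rcases T with c₄ | d₄ <;>
      first
        | exact PEmpty.elim f
        | exact PEmpty.elim g
        | exact PEmpty.elim h
        | exact Category.assoc (obj := C) f g h
        | exact Category.assoc (obj := D) f g h
        | exact assoc₁ f g h
        | exact assoc₂ f g h
        | exact assoc₃ f g h

/-- An element of `H(c, d)`, seen as a map of the collage. -/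
def homOfElement {c : C} {d : D} (x : (H.obj (op c)).obj d) : (inl c : Collage H) ⟶ inr d := x

variable (H)

/-- The inclusion of `C` in the collage. -/
@[simps obj]
def inlFunctor : C ⥤ Collage H where
  obj := inl
  map f := f

/-- The inclusion of `D` in the collage. -/
@[simps obj]
def inrFunctor : D ⥤ Collage H where
  obj := inr
  map f := f

/-- The category of elements of `H(c, -)`, as the category of maps of the collage from `c` to
objects of `D`. -/
@[simps]
def elementsToUnder (c : C) :
    (H.obj (op c)).Elements ⥤ Under ((inlFunctor H).obj c) where
  obj x := Under.mk (Y := inr x.1) (homOfElement (H := H) x.2)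
  map {x y} k := Under.homMk ((inrFunctor H).map k.1) k.2

end Collage

section Matching

variable {C : Type u} [Category.{v} C] {D : Type u} [Category.{v} D] (H : Cᵒᵖ ⥤ D ⥤ Type v)
  (E : Type u₂) [Category.{v₂} E] [∀ c : C, HasLimitsOfShape (H.obj (op c)).Elements E]

variable {E} in
/-- The limit of `X : D ⥤ E` weighted by `H(c, -)`, that is, the limit of `X` over the category
of elements of `H(c, -)`. -/
def matchingObj (X : D ⥤ E) (c : C) : E :=
  limit (CategoryOfElements.π (H.obj (op c)) ⋙ X)

variable {E} in
/-- The projection of the weighted limit at an element of `H(c, d)`. -/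
def matchingProj (X : D ⥤ E) {c : C} {d : D} (x : (H.obj (op c)).obj d) :
    matchingObj H X c ⟶ X.obj d :=
  limit.π (CategoryOfElements.π (H.obj (op c)) ⋙ X) ⟨d, x⟩

variable {E} in
theorem matchingObj_hom_ext (X : D ⥤ E) {c : C} {T : E} {a b : T ⟶ matchingObj H X c}
    (h : ∀ {d : D} (x : (H.obj (op c)).obj d),
      a ≫ matchingProj H X x = b ≫ matchingProj H X x) : a = b :=
  limit.hom_ext fun x => h x.2

variable {E} in
/-- The action of the weighted limit on a map `c ⟶ c'`, by reindexing. -/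
def matchingMap (X : D ⥤ E) {c c' : C} (k : c ⟶ c') : matchingObj H X c ⟶ matchingObj H X c' :=
  limit.lift (CategoryOfElements.π (H.obj (op c')) ⋙ X)
    (Cone.mk (matchingObj H X c)
      { app := fun x => matchingProj H X ((H.map k.op).app x.1 x.2)
        naturality := fun x y h => by
          have := limit.w (CategoryOfElements.π (H.obj (op c)) ⋙ X)
            ((NatTrans.mapElements (H.map k.op)).map h)
          exact (Category.id_comp _).trans this.symm })

variable {E} in
@[simp]
theorem matchingMap_proj (X : D ⥤ E) {c c' : C} (k : c ⟶ c') {d : D}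
    (x : (H.obj (op c')).obj d) :
    matchingMap H X k ≫ matchingProj H X x = matchingProj H X ((H.map k.op).app d x) :=
  limit.lift_π _ _

variable {E} in
/-- The action of the weighted limit on a map of diagrams. -/
def matchingHom {X Y : D ⥤ E} (t : X ⟶ Y) (c : C) : matchingObj H X c ⟶ matchingObj H Y c :=
  limMap (Functor.whiskerLeft (CategoryOfElements.π (H.obj (op c))) t)

variable {E} in
@[simp]
theorem matchingHom_proj {X Y : D ⥤ E} (t : X ⟶ Y) {c : C} {d : D} (x : (H.obj (op c)).obj d) :
    matchingHom H t c ≫ matchingProj H Y x = matchingProj H X x ≫ t.app d :=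
  limMap_π _ _

/-- The matching object functor of `H`, sending `X : D ⥤ E` to the diagram on `C` whose value
at `c` is the limit of `X` weighted by `H(c, -)`.  It is the restriction to `C` of the right Kan
extension of `X` along the inclusion of `D` in the collage of `H`. -/
@[simps]
def matching : (D ⥤ E) ⥤ (C ⥤ E) where
  obj X :=
    { obj := matchingObj H X
      map := matchingMap H X
      map_id := fun c => matchingObj_hom_ext H X fun x => by simp
      map_comp := fun k l => matchingObj_hom_ext H X fun x => by simp }
  map {X Y} t :=
    { app := matchingHom H t
      naturality := fun c c' k => matchingObj_hom_ext H Y fun x => by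
        rw [Category.assoc, Category.assoc, matchingHom_proj, matchingMap_proj,
          matchingHom_proj, ← Category.assoc, matchingMap_proj] }
  map_id X := by
    ext c
    exact matchingObj_hom_ext H X fun x => by simp
  map_comp {X Y Z} s t := by
    ext c
    exact matchingObj_hom_ext H Z fun x => by
      rw [NatTrans.comp_app, Category.assoc, matchingHom_proj, matchingHom_proj,
        ← Category.assoc, matchingHom_proj, Category.assoc, NatTrans.comp_app]

end Matching

/-! ### Iterated gluing diagrams -/

/-- A strict inverse structure: maps that are not isomorphisms strictly lower the degree,
isomorphisms preserve it, and every isomorphism is an identity. -/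
structure StrictInverseStructure (N : Type u) [Category.{v} N] where
  deg : N → ℕ
  deg_lt : ∀ {m n : N} (f : m ⟶ n), ¬ IsIso f → deg n < deg m
  deg_eq : ∀ {m n : N} (f : m ⟶ n), IsIso f → deg m = deg n
  eq_id : ∀ {m n : N} (f : m ⟶ n), IsIso f → ∃ h : m = n, f = eqToHom h

/-- For a diagram `I` of small categories indexed by `Nᵒᵖ`, the colimit of the `I m` weighted by
the non-identity maps `n ⟶ m`, i.e. the colimit of `I` over the opposite of `(n/N)°`. -/
def interior {N : Type u} [SmallCategory N] (I : Nᵒᵖ ⥤ Cat.{u, u}) (n : N) : Cat.{u, u} :=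
  colimit ((Boundary.proj n).op ⋙ I)

/-- The leg `I m ⟶ I_{<n}` at a non-identity map `n ⟶ m`. -/
def interiorLeg {N : Type u} [SmallCategory N] (I : Nᵒᵖ ⥤ Cat.{u, u}) (n : N) (a : Boundary n) :
    I.obj (op a.obj.right) ⟶ interior I n :=
  colimit.ι ((Boundary.proj n).op ⋙ I) (op a)

/-- The data of an iterated gluing diagram.  Maps of `I n` between the boundary `∂I n` and the
interior `I_{<n}` go from the boundary to the interior, so the attaching profunctor at `n` is
contravariant in the boundary and covariant in the interior.  The diagram `I` is identified with
the collages through isomorphisms of categories which are compatible with the canonical maps from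
the earlier stages. -/
structure IteratedGluingDiagram where
  /-- the indexing category -/
  N : Type u
  [category : SmallCategory N]
  inverse : StrictInverseStructure N
  /-- the stages -/
  I : Nᵒᵖ ⥤ Cat.{u, u}
  /-- the boundaries -/
  bd : N → Cat.{u, u}
  /-- the attaching profunctors -/
  attach : ∀ n : N, (bd n)ᵒᵖ ⥤ interior I n ⥤ Type u
  glue : ∀ n : N, I.obj (op n) ≅ Cat.of (Collage (attach n))
  glue_comp : ∀ (n : N) (a : Boundary n),
    I.map a.obj.hom.op ≫ (glue n).hom =
      interiorLeg I n a ≫ (Collage.inrFunctor (attach n)).toCatHom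

attribute [instance] IteratedGluingDiagram.category

namespace IteratedGluingDiagram

variable (D : IteratedGluingDiagram.{u})

/-- The iterated gluing category: the colimit of all stages. -/
def total : Cat.{u, u} := colimit D.I

/-- The functor from the collage at `n` to the iterated gluing category. -/
def fromCollage (n : D.N) : Collage (D.attach n) ⥤ D.total :=
  (D.glue n).inv.toFunctor ⋙ (colimit.ι D.I (op n)).toFunctor

/-- The functor from the `n`-th boundary to the iterated gluing category. -/
abbrev fromBd (n : D.N) : D.bd n ⥤ D.total :=
  Collage.inlFunctor (D.attach n) ⋙ D.fromCollage n

/-- The functor from the `n`-th interior to the iterated gluing category. -/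
abbrev fromInterior (n : D.N) : interior D.I n ⥤ D.total :=
  Collage.inrFunctor (D.attach n) ⋙ D.fromCollage n

/-- `i/I_{<n}`: the maps in the `n`-th stage from the boundary object `i` to the interior, i.e.
the category of elements of the attaching profunctor at `i`. -/
abbrev LowerSlice {n : D.N} (i : D.bd n) : Type u := ((D.attach n).obj (op i)).Elements

variable (W : MorphismProperty D.total)

/-- `[i]`: the object of the homotopy category given by a boundary object `i`. -/
abbrev hoObj {n : D.N} (i : D.bd n) : W.Localization :=
  (D.fromBd n ⋙ W.Q).obj i

/-- The functor from `i/I_{<n}` to the slice of the homotopy category under `[i]`, induced by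
the localisation. -/
def toHoUnder {n : D.N} (i : D.bd n) : D.LowerSlice i ⥤ Under (D.hoObj W i) :=
  Collage.elementsToUnder (D.attach n) i ⋙ Under.post (D.fromCollage n ⋙ W.Q)

/-- The localisation restricts to an initial functor from `i/I_{<n}` to the slice of the homotopy
category under `[i]` with the identity removed. -/
def RestrictsToInitial {n : D.N} (i : D.bd n) : Prop :=
  ∃ h : ∀ x : D.LowerSlice i, (D.toHoUnder W i).obj x ≠ Under.mk (𝟙 (D.hoObj W i)),
    (ObjectProperty.lift (fun X : Under (D.hoObj W i) => X ≠ Under.mk (𝟙 _))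
      (D.toHoUnder W i) h).Initial

end IteratedGluingDiagram

end GluingPi

end

/-! The dependent product of `X ⟶ B` along `f` in a functor category is sought pointwise. A
`T`-shaped element of it at `c` is a `Family`: compatible maps `T ×_{A d} B d ⟶ X d` over `B d`, one
for each `k : c ⟶ d`. If such families are representable at every `c`, Yoneda assembles the
representing objects into a functor, and this is the dependent product (`exists_isPi`).

Suppose that every map of the index category either lowers a degree, or preserves it and is inverted
by `A` and `B`. A family at `c` is then a section over `f.app c` together with a family on the
degree-lowering maps, the two agreeing in the relative matching object. Sections are represented by
dependent products along the powerful map `f.app c`, and lower families by a limit of dependent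
products already built. A pullback of these represents families at `c` (`representableAt_of_lower`),
and induction on the degree gives all objects.

For a functor `γ : J ⥤ H` that is initial on lower slices, restricting families from `γ.obj c` to
`c` is bijective (`Family.along_bijective`), because a lower family is determined by, and can be
prescribed on, the image of an initial functor. Hence restriction along `γ` preserves pointwise
universal evaluations, and the comparison is invertible.

It remains to find degrees. The stages form a diagram of discrete opfibrations whose objects are
freely generated by the boundaries (`isFreeOn`). So each object of the colimit comes from the
boundary of exactly one stage, the legs are discrete opfibrations, and the lower slice at `[i]` is
equivalent to `i/I_{<n}`. The third assumption forces non-identity maps of the homotopy category to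
lower the degree (`hoDegree_lt_or_eq_eqToHom`). Lower slices there are thus the categories
`(c/Ho)°`, and the same assumption is the required initiality. -/

noncomputable section

attribute [local simp] pullback.lift_fst pullback.lift_snd pullback.lift_fst_assoc
  pullback.lift_snd_assoc

namespace GluingPi

/-! ### Compatible families -/

section Family

variable {C : Type u} [Category.{v} C] {E : Type u₁} [Category.{v₁} E]
  {A B X : C ⥤ E} (f : B ⟶ A) (p : X ⟶ B)

/-- A generalized element, of shape `T` and lying over `a`, of the pointwise dependent product of
`p : X ⟶ B` along `f : B ⟶ A` at the object `c`: a compatible family of maps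
`T ×_{A d} B d ⟶ X d` over `B d`, indexed by the maps `k : c ⟶ d`, where the maps
out of the pullback are described by their action on generalized elements. -/
structure Family (c : C) {T : E} (a : T ⟶ A.obj c) where
  /-- the action on generalized elements -/
  app : ∀ {Z : E} (t : Z ⟶ T) {d : C} (k : c ⟶ d) (b : Z ⟶ B.obj d),
    b ≫ f.app d = t ≫ a ≫ A.map k → (Z ⟶ X.obj d)
  app_over : ∀ {Z : E} (t : Z ⟶ T) {d : C} (k : c ⟶ d) (b : Z ⟶ B.obj d)
    (h : b ≫ f.app d = t ≫ a ≫ A.map k), app t k b h ≫ p.app d = b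
  app_comp : ∀ {Z Z' : E} (z : Z' ⟶ Z) (t : Z ⟶ T) {d : C} (k : c ⟶ d) (b : Z ⟶ B.obj d)
    (h : b ≫ f.app d = t ≫ a ≫ A.map k) (h' : (z ≫ b) ≫ f.app d = (z ≫ t) ≫ a ≫ A.map k),
    z ≫ app t k b h = app (z ≫ t) k (z ≫ b) h'
  app_map : ∀ {Z : E} (t : Z ⟶ T) {d e : C} (k : c ⟶ d) (l : d ⟶ e) (b : Z ⟶ B.obj d)
    (h : b ≫ f.app d = t ≫ a ≫ A.map k)
    (h' : (b ≫ B.map l) ≫ f.app e = t ≫ a ≫ A.map (k ≫ l)),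
    app t k b h ≫ X.map l = app t (k ≫ l) (b ≫ B.map l) h'

variable {f p}

namespace Family

variable {c : C} {T : E} {a : T ⟶ A.obj c}

@[ext]
theorem ext {φ ψ : Family f p c a}
    (h : ∀ {Z : E} (t : Z ⟶ T) {d : C} (k : c ⟶ d) (b : Z ⟶ B.obj d)
      (h : b ≫ f.app d = t ≫ a ≫ A.map k), φ.app t k b h = ψ.app t k b h) : φ = ψ := by
  cases φ
  cases ψ
  congr
  funext Z t d k b hb
  exact h t k b hb

theorem app_congr (φ : Family f p c a) {Z : E} {t t' : Z ⟶ T} (ht : t = t') {d : C}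
    {k k' : c ⟶ d} (hk : k = k') {b b' : Z ⟶ B.obj d} (hb : b = b')
    (h : b ≫ f.app d = t ≫ a ≫ A.map k) :
    φ.app t k b h = φ.app t' k' b' (by subst ht hk hb; exact h) := by
  subst ht hk hb
  rfl

/-- The action of a map `s : T' ⟶ T` on elements of shape `T`. -/
@[simps]
def restrict (φ : Family f p c a) {T' : E} (s : T' ⟶ T) (a' : T' ⟶ A.obj c) (ha : s ≫ a = a') :
    Family f p c a' where
  app t _ k b h := φ.app (t ≫ s) k b (by rw [h, ← ha]; simp)
  app_over t _ k b h := φ.app_over _ _ _ _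
  app_comp z t _ k b h h' := by
    rw [φ.app_comp z (t ≫ s) k b _ (by rw [h', ← ha]; simp)]
    exact φ.app_congr (by simp) rfl rfl _
  app_map t _ _ k l b h h' := φ.app_map _ _ _ _ _ _

/-- The action of a map `j : c ⟶ c'` of the indexing category. -/
@[simps]
def reindex (φ : Family f p c a) {c' : C} (j : c ⟶ c') (a' : T ⟶ A.obj c')
    (ha : a ≫ A.map j = a') : Family f p c' a' where
  app t _ k b h := φ.app t (j ≫ k) b (by rw [h, ← ha]; simp)
  app_over t _ k b h := φ.app_over _ _ _ _
  app_comp z t _ k b h h' := φ.app_comp _ _ _ _ _ _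
  app_map t _ e k l b h h' := by
    rw [φ.app_map t (j ≫ k) l b _ (by rw [h', ← ha]; simp)]
    exact φ.app_congr rfl (by simp) rfl _

theorem restrict_restrict (φ : Family f p c a) {T' T'' : E} (s : T' ⟶ T) (a' : T' ⟶ A.obj c)
    (ha : s ≫ a = a') (s' : T'' ⟶ T') (a'' : T'' ⟶ A.obj c) (ha' : s' ≫ a' = a'') :
    (φ.restrict s a' ha).restrict s' a'' ha' =
      φ.restrict (s' ≫ s) a'' (by rw [Category.assoc, ha, ha']) := by
  ext Z t d k b h
  exact φ.app_congr (by simp) rfl rfl _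

theorem restrict_id (φ : Family f p c a) : φ.restrict (𝟙 T) a (by simp) = φ := by
  ext Z t d k b h
  exact φ.app_congr (by simp) rfl rfl _

theorem reindex_reindex (φ : Family f p c a) {c' c'' : C} (j : c ⟶ c') (a' : T ⟶ A.obj c')
    (ha : a ≫ A.map j = a') (j' : c' ⟶ c'') (a'' : T ⟶ A.obj c'') (ha' : a' ≫ A.map j' = a'') :
    (φ.reindex j a' ha).reindex j' a'' ha' =
      φ.reindex (j ≫ j') a'' (by rw [A.map_comp, ← Category.assoc, ha, ha']) := by
  ext Z t d k b h
  exact φ.app_congr rfl (by simp) rfl _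

theorem reindex_id (φ : Family f p c a) : φ.reindex (𝟙 c) a (by simp) = φ := by
  ext Z t d k b h
  exact φ.app_congr rfl (by simp) rfl _

theorem restrict_reindex (φ : Family f p c a) {T' : E} (s : T' ⟶ T) (a' : T' ⟶ A.obj c)
    (ha : s ≫ a = a') {c' : C} (j : c ⟶ c') (a₁ : T ⟶ A.obj c') (ha₁ : a ≫ A.map j = a₁)
    (a₁' : T' ⟶ A.obj c') (ha₁' : a' ≫ A.map j = a₁') :
    (φ.restrict s a' ha).reindex j a₁' ha₁' =
      (φ.reindex j a₁ ha₁).restrict s a₁' (by rw [← ha₁, ← Category.assoc, ha, ha₁']) := by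
  ext Z t d k b h
  rfl

/-- A family is universal if it exhibits its shape as the pointwise dependent product. -/
def IsUniversal {P : E} {q : P ⟶ A.obj c} (Φ : Family f p c q) : Prop :=
  ∀ {T : E} (a : T ⟶ A.obj c) (ψ : Family f p c a),
    ∃! m : T ⟶ P, ∃ h : m ≫ q = a, Φ.restrict m a h = ψ

theorem IsUniversal.hom_ext {P : E} {q : P ⟶ A.obj c} {Φ : Family f p c q} (hΦ : Φ.IsUniversal)
    {T : E} {m m' : T ⟶ P} (a : T ⟶ A.obj c) (h : m ≫ q = a) (h' : m' ≫ q = a)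
    (e : Φ.restrict m a h = Φ.restrict m' a h') : m = m' :=
  (hΦ a _).unique ⟨h, e⟩ ⟨h', rfl⟩

end Family

variable (f p) in
/-- The pointwise dependent product of `p` along `f` exists at `c`. -/
def RepresentableAt (c : C) : Prop :=
  ∃ (P : E) (q : P ⟶ A.obj c) (Φ : Family f p c q), Φ.IsUniversal

/-- Reindexing along `j` is natural in the shape, so by Yoneda it is induced by a map of
representing objects, functorially by uniqueness. The functor `i` serves both for the whole index
category and for the projection of a lower slice. -/
theorem exists_functor_of_representableAt {S : Type u₂} [Category.{v₂} S] (i : S ⥤ C)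
    (h : ∀ s, RepresentableAt f p (i.obj s)) :
    ∃ (Y : S ⥤ E) (q : Y ⟶ i ⋙ A) (Φ : ∀ s, Family f p (i.obj s) (q.app s)),
      (∀ s, (Φ s).IsUniversal) ∧ ∀ {s s' : S} (j : s ⟶ s'),
        (Φ s').restrict (Y.map j) _ (q.naturality j) = (Φ s).reindex (i.map j) _ rfl := by
  choose P q Φ hΦ using h
  choose m hm hm' using fun {s s' : S} (j : s ⟶ s') =>
    (hΦ s' (q s ≫ A.map (i.map j)) ((Φ s).reindex (i.map j) _ rfl)).exists
  refine ⟨{ obj := P, map := m, map_id := fun s => ?_, map_comp := fun {s s' s''} j j' => ?_ },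
    { app := q, naturality := fun _ _ j => hm j }, Φ, hΦ, hm'⟩
  · refine Family.IsUniversal.hom_ext (hΦ s) (q s) (by simp [hm]) (by simp) ?_
    rw [Family.restrict_id]
    have := hm' (𝟙 s)
    ext Z t d k b h
    have e := congrArg (fun φ => φ.app t k b (by simpa using h)) this
    refine e.trans ?_
    exact (Φ s).app_congr rfl (by simp) rfl _
  · refine Family.IsUniversal.hom_ext (hΦ s'') (q s ≫ A.map (i.map (j ≫ j'))) (hm _) (by simp [hm, reassoc_of% hm]) ?_
    rw [hm']
    rw [← Family.restrict_restrict (Φ s'') (m j') _ (hm j') (m j) _ (by simp [reassoc_of% hm]),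
      hm', ← Family.restrict_reindex (Φ s') (m j) _ (hm j) (i.map j') _ rfl _ (by simp),
      hm', Family.reindex_reindex]
    ext Z t d k b h
    exact (Φ s).app_congr rfl (by simp) rfl _

/-! ### Evaluations -/

variable (f p) in
/-- A map `Y ×_A B ⟶ X` over `B`, described by its action on generalized elements. -/
structure Evaluation {Y : C ⥤ E} (q : Y ⟶ A) where
  /-- the action on generalized elements -/
  app : ∀ {Z : E} {d : C} (y : Z ⟶ Y.obj d) (b : Z ⟶ B.obj d),
    b ≫ f.app d = y ≫ q.app d → (Z ⟶ X.obj d)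
  app_over : ∀ {Z : E} {d : C} (y : Z ⟶ Y.obj d) (b : Z ⟶ B.obj d)
    (h : b ≫ f.app d = y ≫ q.app d), app y b h ≫ p.app d = b
  app_comp : ∀ {Z Z' : E} (z : Z' ⟶ Z) {d : C} (y : Z ⟶ Y.obj d) (b : Z ⟶ B.obj d)
    (h : b ≫ f.app d = y ≫ q.app d) (h' : (z ≫ b) ≫ f.app d = (z ≫ y) ≫ q.app d),
    z ≫ app y b h = app (z ≫ y) (z ≫ b) h'
  app_map : ∀ {Z : E} {d e : C} (l : d ⟶ e) (y : Z ⟶ Y.obj d) (b : Z ⟶ B.obj d)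
    (h : b ≫ f.app d = y ≫ q.app d)
    (h' : (b ≫ B.map l) ≫ f.app e = (y ≫ Y.map l) ≫ q.app e),
    app y b h ≫ X.map l = app (y ≫ Y.map l) (b ≫ B.map l) h'

namespace Evaluation

variable {Y : C ⥤ E} {q : Y ⟶ A} (ev : Evaluation f p q)

@[ext]
theorem ext {ev ev' : Evaluation f p q}
    (h : ∀ {Z : E} {d : C} (y : Z ⟶ Y.obj d) (b : Z ⟶ B.obj d)
      (h : b ≫ f.app d = y ≫ q.app d), ev.app y b h = ev'.app y b h) : ev = ev' := by
  cases ev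
  cases ev'
  congr
  funext Z d y b hb
  exact h y b hb

theorem app_congr {Z : E} {d : C} {y y' : Z ⟶ Y.obj d} (hy : y = y')
    {b b' : Z ⟶ B.obj d} (hb : b = b') (h : b ≫ f.app d = y ≫ q.app d) :
    ev.app y b h = ev.app y' b' (by subst hy hb; exact h) := by
  subst hy hb
  rfl

/-- The family obtained by evaluating a generalized element of `Y`. -/
@[simps]
def family {c : C} {T : E} (m : T ⟶ Y.obj c) (a : T ⟶ A.obj c) (ha : m ≫ q.app c = a) :
    Family f p c a where
  app t _ k b h := ev.app (t ≫ m ≫ Y.map k) b (by rw [h, ← ha]; simp)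
  app_over t _ k b h := ev.app_over _ _ _
  app_comp z t _ k b h h' := by
    rw [ev.app_comp z (t ≫ m ≫ Y.map k) b _ (by rw [h', ← ha]; simp)]
    exact ev.app_congr (by simp) rfl _
  app_map t _ _ k l b h h' := by
    rw [ev.app_map l (t ≫ m ≫ Y.map k) b _ (by rw [h', ← ha]; simp)]
    exact ev.app_congr (by simp) rfl _

theorem family_restrict {c : C} {T T' : E} (m : T ⟶ Y.obj c) (a : T ⟶ A.obj c)
    (ha : m ≫ q.app c = a) (s : T' ⟶ T) (a' : T' ⟶ A.obj c) (ha' : s ≫ a = a') :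
    (ev.family m a ha).restrict s a' ha' =
      ev.family (s ≫ m) a' (by rw [Category.assoc, ha, ha']) := by
  ext Z t d k b h
  exact ev.app_congr (by simp) rfl _

theorem family_reindex {c c' : C} {T : E} (m : T ⟶ Y.obj c) (a : T ⟶ A.obj c)
    (ha : m ≫ q.app c = a) (j : c ⟶ c') (a' : T ⟶ A.obj c') (ha' : a ≫ A.map j = a') :
    (ev.family m a ha).reindex j a' ha' =
      ev.family (m ≫ Y.map j) a' (by rw [Category.assoc, q.naturality, ← ha', ← ha]; simp) := by
  ext Z t d k b h
  exact ev.app_congr (by simp) rfl _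

/-- An evaluation is pointwise universal if `Y` is the pointwise dependent product. -/
def PointwiseUniversal : Prop :=
  ∀ (c : C) {T : E} (a : T ⟶ A.obj c) (ψ : Family f p c a),
    ∃! m : T ⟶ Y.obj c, ∃ h : m ≫ q.app c = a, ev.family m a h = ψ

variable {ev}

theorem PointwiseUniversal.hom_ext (hev : ev.PointwiseUniversal) {c : C} {T : E}
    {m m' : T ⟶ Y.obj c} (a : T ⟶ A.obj c) (h : m ≫ q.app c = a) (h' : m' ≫ q.app c = a)
    (e : ev.family m a h = ev.family m' a h') : m = m' :=
  (hev c a _).unique ⟨h, e⟩ ⟨h', rfl⟩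

/-- Precomposition of an evaluation with a map over `A`. -/
@[simps]
def precomp (ev : Evaluation f p q) {Y' : C ⥤ E} {q' : Y' ⟶ A} (m : Y' ⟶ Y) (hm : m ≫ q = q') :
    Evaluation f p q' where
  app y b h := ev.app (y ≫ m.app _) b (by rw [h, ← hm]; simp)
  app_over y b h := ev.app_over _ _ _
  app_comp z _ y b h h' := by
    rw [ev.app_comp z (y ≫ m.app _) b _ (by rw [h', ← hm]; simp)]
    exact ev.app_congr (by simp) rfl _
  app_map l y b h h' := by
    rw [ev.app_map l (y ≫ m.app _) b _ (by rw [h', ← hm]; simp)]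
    exact ev.app_congr (by simp) rfl _

/-- The component at `c` classifies the family that `ev'` gives on the generic element `𝟙 (Y'.obj
c)`. It is natural because both composites classify the family of `Y'.map k`. -/
theorem PointwiseUniversal.existsUnique (hev : ev.PointwiseUniversal) {Y' : C ⥤ E} {q' : Y' ⟶ A}
    (ev' : Evaluation f p q') :
    ∃! m : Y' ⟶ Y, ∃ h : m ≫ q = q', ev.precomp m h = ev' := by
  choose m hm hm' using fun c : C =>
    (hev c (q'.app c) (ev'.family (𝟙 (Y'.obj c)) _ (by simp))).exists
  refine ⟨{ app := m, naturality := fun c d k => ?_ }, ⟨?_, ?_⟩, ?_⟩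
  · refine hev.hom_ext (q'.app c ≫ A.map k) (by simp [hm]) (by simp [reassoc_of% hm]) ?_
    rw [← ev.family_restrict (m d) _ (hm d) (Y'.map k) _ (by simp), hm',
      ← ev.family_reindex (m c) _ (hm c) k _ rfl, hm', ev'.family_restrict, ev'.family_reindex]
    congr 1
    simp
  · ext c
    exact hm c
  · ext Z d y b h
    have e := congrArg (fun φ => φ.app y (𝟙 d) b (by simpa using h)) (hm' d)
    refine (ev.app_congr (by simp) rfl _).trans (e.trans (ev'.app_congr (by simp) rfl _))
  · rintro m' ⟨h, e⟩
    ext c : 2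
    refine hev.hom_ext (q'.app c) (by rw [← h]; simp) (hm c) ?_
    rw [hm', ← e]
    ext Z t d k b h
    exact ev.app_congr (by simp) rfl _

theorem PointwiseUniversal.precomp_isIso (hev : ev.PointwiseUniversal) {Y' : C ⥤ E}
    {q' : Y' ⟶ A} (m : Y' ⟶ Y) [IsIso m] (hm : m ≫ q = q') :
    (ev.precomp m hm).PointwiseUniversal := by
  have key : ∀ {c : C} {T : E} (n : T ⟶ Y'.obj c) (a : T ⟶ A.obj c) (ha : n ≫ q'.app c = a),
      (ev.precomp m hm).family n a ha =
        ev.family (n ≫ m.app c) a (by rw [← ha, ← hm]; simp) := fun n a ha => by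
    ext Z t d k b h
    exact ev.app_congr (by simp) rfl _
  intro c T a ψ
  obtain ⟨n, ⟨hn, hn'⟩, huniq⟩ := hev c a ψ
  refine ⟨n ≫ inv (m.app c), ⟨by rw [← hn, ← hm]; simp, ?_⟩, ?_⟩
  · rw [key, ← hn']
    congr 1
    simp
  · rintro n' ⟨h, h'⟩
    rw [key] at h'
    rw [← huniq _ ⟨_, h'⟩]
    simp

end Evaluation

/-- The value of the evaluation at `y` and `b` is that of the universal family at the identity of
`d`. The families it induces are then restrictions of the universal ones, so universality carries
over. -/
theorem exists_pointwiseUniversal (h : ∀ c, RepresentableAt f p c) :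
    ∃ (Y : C ⥤ E) (q : Y ⟶ A) (ev : Evaluation f p q), ev.PointwiseUniversal := by
  obtain ⟨Y, q, Φ, hΦ, hY⟩ := exists_functor_of_representableAt (𝟭 C) h
  -- The universal family at `c` is determined by the values of the others at identities.
  have key : ∀ {c d : C} (k : c ⟶ d) {Z : E} (t : Z ⟶ Y.obj c) (b : Z ⟶ B.obj d) (h₁ h₂),
      (Φ d).app (t ≫ Y.map k) (𝟙 d) b h₁ = (Φ c).app t k b h₂ := fun {c d} k Z t b h₁ h₂ => by
    have e := congrArg (fun φ => φ.app t (𝟙 d) b (by rw [h₂]; simp)) (hY k)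
    exact e.trans ((Φ c).app_congr rfl (by simp) rfl _)
  let ev : Evaluation f p (Y := Y) q :=
    { app := fun {Z d} y b h => (Φ d).app y (𝟙 d) b (by rw [h]; simp)
      app_over := fun y b h => (Φ _).app_over _ _ _ _
      app_comp := fun z d y b h h' => (Φ _).app_comp _ _ _ _ _ _
      app_map := fun {Z d e} l y b h h' => by
        rw [(Φ d).app_map y (𝟙 d) l b _ (by rw [h']; simp), key l y (b ≫ B.map l) _ (by rw [h']; simp)]
        exact (Φ d).app_congr rfl (by simp) rfl _ }
  have hfam : ∀ (c : C) {T : E} (m : T ⟶ Y.obj c) (a : T ⟶ A.obj c) (ha : m ≫ q.app c = a),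
      ev.family m a ha = (Φ c).restrict m a ha := fun c T m a ha => by
    ext Z t d k b h
    have h' : b ≫ f.app d = ((t ≫ m) ≫ Y.map k) ≫ q.app d ≫ A.map (𝟙 d) := by
      rw [h, ← ha]; simp
    exact ((Φ d).app_congr (by simp) rfl rfl _).trans (key k (t ≫ m) b h' _)
  refine ⟨Y, q, ev, fun c T a ψ => ?_⟩
  simp only [hfam]
  exact hΦ c a ψ

end Family

/-! ### Dependent products in functor categories -/

section Over

variable {C : Type u} [Category.{v} C]

/-- The universal property of a dependent product with its evaluation. -/
def IsPi {B A : C} (f : B ⟶ A) [HasPullbacksAlong f] {Y : Over A} {X : Over B}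
    (g : (Over.pullback f).obj Y ⟶ X) : Prop :=
  ∀ Y' : Over A, Function.Bijective fun m : Y' ⟶ Y => (Over.pullback f).map m ≫ g

theorem isPi_counit {B A : C} {f : B ⟶ A} [HasPullbacksAlong f] {P : Over B ⥤ Over A}
    (adj : Over.pullback f ⊣ P) (X : Over B) : IsPi f (adj.counit.app X) := fun Y' => by
  have : (fun m : Y' ⟶ P.obj X => (Over.pullback f).map m ≫ adj.counit.app X) =
      (adj.homEquiv Y' X).symm := by
    funext m
    exact (adj.homEquiv_counit Y' X m).symm
  rw [this]
  exact (adj.homEquiv Y' X).symm.bijective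

/-- By Yoneda, since composing with the transpose is a composite of two bijections. The components
of `piComparison` are such transposes, so they are invertible once the untransposed maps are
universal. -/
theorem IsPi.isIso_homEquiv {B A : C} {f : B ⟶ A} [HasPullbacksAlong f] {P : Over B ⥤ Over A}
    (adj : Over.pullback f ⊣ P) {Y : Over A} {X : Over B}
    {g : (Over.pullback f).obj Y ⟶ X} (hg : IsPi f g) : IsIso (adj.homEquiv Y X g) := by
  refine isIso_of_yoneda_map_bijective _ fun T => ?_
  have : (fun x : T ⟶ Y => x ≫ adj.homEquiv Y X g) =
      adj.homEquiv T X ∘ fun m => (Over.pullback f).map m ≫ g := by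
    funext m
    simp [Adjunction.homEquiv_naturality_left]
  rw [this]
  exact (adj.homEquiv T X).bijective.comp (hg T)

/-- A universal evaluation is a terminal object of the comma category of pullback over `X`. -/
theorem isLeftAdjoint_of_exists_isPi {B A : C} (f : B ⟶ A) [HasPullbacksAlong f]
    (h : ∀ X : Over B, ∃ (Y : Over A) (g : (Over.pullback f).obj Y ⟶ X), IsPi f g) :
    (Over.pullback f).IsLeftAdjoint := by
  have : ∀ X : Over B, HasTerminal (CostructuredArrow (Over.pullback f) X) := fun X => by
    obtain ⟨Y, g, hg⟩ := h X
    refine IsTerminal.hasTerminal (X := CostructuredArrow.mk g) ?_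
    refine IsTerminal.ofUniqueHom
      (fun K => CostructuredArrow.homMk ((hg K.left).2 K.hom).choose
        ((hg K.left).2 K.hom).choose_spec) fun K m => ?_
    ext1
    refine (hg K.left).1 ?_
    exact (CostructuredArrow.w m).trans ((hg K.left).2 K.hom).choose_spec.symm
  exact isLeftAdjoint_of_costructuredArrowTerminals _

variable {E : Type u₁} [Category.{v₁} E] [HasPullbacks E] {A B : C ⥤ E} {f : B ⟶ A}

theorem isPullback_app {A B Y : C ⥤ E} (q : Y ⟶ A) (f : B ⟶ A) (d : C) :
    IsPullback ((pullback.fst q f).app d) ((pullback.snd q f).app d) (q.app d) (f.app d) :=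
  (IsPullback.of_hasPullback q f).map ((evaluation C E).obj d)

/-- A map `Y ×_A B ⟶ X` over `B` seen as an operation on generalized elements. -/
@[simps]
def Evaluation.ofHom {Y : Over A} {X : Over B} (g : (Over.pullback f).obj Y ⟶ X) :
    Evaluation f X.hom Y.hom where
  app {Z d} y b h := (isPullback_app Y.hom f d).lift y b h.symm ≫ g.left.app d
  app_over {Z d} y b h := by
    have := congrArg (fun k => k.app d) (Over.w g)
    simp only [NatTrans.comp_app] at this
    rw [Category.assoc, this]
    exact (isPullback_app Y.hom f d).lift_snd _ _ _
  app_comp z d y b h h' := by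
    rw [← Category.assoc]
    congr 1
    apply (isPullback_app Y.hom f d).hom_ext <;> simp
  app_map {Z d e} l y b h h' := by
    rw [Category.assoc, ← g.left.naturality, ← Category.assoc]
    congr 1
    apply (isPullback_app Y.hom f e).hom_ext
    · rw [Category.assoc]
      erw [(pullback.fst Y.hom f).naturality l]
      simp
    · rw [Category.assoc]
      erw [(pullback.snd Y.hom f).naturality l]
      simp

/-- The map `Y ×_A B ⟶ X` over `B` with a given action on generalized elements. -/
def Evaluation.hom {Y : Over A} {X : Over B} (ev : Evaluation f X.hom Y.hom) :
    (Over.pullback f).obj Y ⟶ X :=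
  Over.homMk
    { app := fun d => ev.app ((pullback.fst Y.hom f).app d) ((pullback.snd Y.hom f).app d)
        (isPullback_app Y.hom f d).w.symm
      naturality := fun d e l => by
        have hw := (isPullback_app Y.hom f d).w
        rw [ev.app_map l _ _ _ (by simp [← reassoc_of% hw])]
        refine (ev.app_comp _ _ _ _ ?_).trans (ev.app_congr ?_ ?_ _)
        · simp [← reassoc_of% hw]
        · exact (pullback.fst Y.hom f).naturality l
        · exact (pullback.snd Y.hom f).naturality l }
    (by ext d; exact ev.app_over _ _ _)

theorem Evaluation.ofHom_hom {Y : Over A} {X : Over B} (ev : Evaluation f X.hom Y.hom) :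
    Evaluation.ofHom ev.hom = ev := by
  ext Z d y b h
  refine (ev.app_comp _ _ _ _ ?_).trans (ev.app_congr ?_ ?_ _)
  · simp [h]
  · exact (isPullback_app Y.hom f d).lift_fst _ _ _
  · exact (isPullback_app Y.hom f d).lift_snd _ _ _

theorem Evaluation.ofHom_injective {Y : Over A} {X : Over B} :
    Function.Injective
      (Evaluation.ofHom : ((Over.pullback f).obj Y ⟶ X) → Evaluation f X.hom Y.hom) := by
  intro g g' e
  ext d
  have := congrArg (fun ev => ev.app ((pullback.fst Y.hom f).app d) ((pullback.snd Y.hom f).app d)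
    (isPullback_app Y.hom f d).w.symm) e
  simp only [ofHom_app] at this
  have h1 : (isPullback_app Y.hom f d).lift ((pullback.fst Y.hom f).app d)
      ((pullback.snd Y.hom f).app d) (isPullback_app Y.hom f d).w.symm.symm = 𝟙 _ := by
    apply (isPullback_app Y.hom f d).hom_ext <;> simp
  rw [h1] at this
  simpa using this

theorem Evaluation.ofHom_comp {Y Y' : Over A} {X : Over B} (g : (Over.pullback f).obj Y ⟶ X)
    (m : Y' ⟶ Y) :
    Evaluation.ofHom ((Over.pullback f).map m ≫ g) =
      (Evaluation.ofHom g).precomp m.left (Over.w m) := by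
  ext Z d y b h
  simp only [ofHom_app, precomp_app, Over.comp_left, NatTrans.comp_app]
  rw [← Category.assoc]
  congr 1
  have h1 := congrArg (fun k => k.app d)
    (pullback.lift_fst (f := Y.hom) (g := f) (pullback.fst Y'.hom f ≫ m.left)
    (pullback.snd Y'.hom f) (by simp [pullback.condition]))
  have h2 := congrArg (fun k => k.app d)
    (pullback.lift_snd (f := Y.hom) (g := f) (pullback.fst Y'.hom f ≫ m.left)
    (pullback.snd Y'.hom f) (by simp [pullback.condition]))
  simp only [NatTrans.comp_app] at h1 h2
  apply (isPullback_app Y.hom f d).hom_ext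
  · simp only [Over.pullback_map_left, Category.assoc, IsPullback.lift_fst, h1]
    rw [← Category.assoc, IsPullback.lift_fst]
  · simp only [Over.pullback_map_left, Category.assoc, IsPullback.lift_snd, h2]

theorem Evaluation.PointwiseUniversal.isPi {Y : Over A} {X : Over B}
    {g : (Over.pullback f).obj Y ⟶ X} (hg : (Evaluation.ofHom g).PointwiseUniversal) :
    IsPi f g := by
  intro Y'
  constructor
  · intro m m' e
    have e' := congrArg Evaluation.ofHom e
    simp only [Evaluation.ofHom_comp] at e'
    ext1
    exact (hg.existsUnique _).unique ⟨Over.w m, rfl⟩ ⟨Over.w m', e'.symm⟩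
  · intro g'
    obtain ⟨m, hm, hm'⟩ := (hg.existsUnique (Evaluation.ofHom g')).exists
    refine ⟨Over.homMk m hm, Evaluation.ofHom_injective ?_⟩
    rw [Evaluation.ofHom_comp]
    exact hm'

theorem exists_isPi {X : Over B} (h : ∀ c, RepresentableAt f X.hom c) :
    ∃ (Y : Over A) (g : (Over.pullback f).obj Y ⟶ X),
      IsPi f g ∧ (Evaluation.ofHom g).PointwiseUniversal := by
  obtain ⟨Y, q, ev, hev⟩ := exists_pointwiseUniversal h
  have h' : (Evaluation.ofHom (Evaluation.hom (Y := Over.mk q) ev)).PointwiseUniversal := by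
    rw [Evaluation.ofHom_hom]
    exact hev
  exact ⟨Over.mk q, Evaluation.hom (Y := Over.mk q) ev, h'.isPi, h'⟩

/-- Dependent products are unique up to isomorphism over `A`, and one of them is pointwise by
construction. This makes the values of an arbitrary right adjoint accessible pointwise. -/
theorem IsPi.pointwiseUniversal {X : Over B} (h : ∀ c, RepresentableAt f X.hom c) {Y : Over A}
    {g : (Over.pullback f).obj Y ⟶ X} (hg : IsPi f g) :
    (Evaluation.ofHom g).PointwiseUniversal := by
  obtain ⟨Y', g', hg', hpt⟩ := exists_isPi h
  obtain ⟨m, hm⟩ := (hg' Y).2 g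
  obtain ⟨m', hm'⟩ := (hg Y').2 g'
  dsimp only at hm hm'
  have e : m ≫ m' = 𝟙 _ := (hg Y).1 (by simp [hm, hm'])
  have e' : m' ≫ m = 𝟙 _ := (hg' Y').1 (by simp [hm, hm'])
  have : IsIso m.left := ⟨m'.left, congrArg (fun k => k.left) e, congrArg (fun k => k.left) e'⟩
  rw [← hm, Evaluation.ofHom_comp]
  exact hpt.precomp_isIso m.left (Over.w m)

end Over

/-! ### Dependent products in terms of generalized elements -/

section LocalSection

variable {E : Type u₁} [Category.{v₁} E] {B A X : E}

/-- A map `T ×_A B ⟶ X` over `B`, described by its action on generalized elements. -/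
structure LocalSection (g : B ⟶ A) (p : X ⟶ B) {T : E} (a : T ⟶ A) where
  /-- the action on generalized elements -/
  app : ∀ {Z : E} (t : Z ⟶ T) (b : Z ⟶ B), b ≫ g = t ≫ a → (Z ⟶ X)
  app_over : ∀ {Z : E} (t : Z ⟶ T) (b : Z ⟶ B) (h : b ≫ g = t ≫ a), app t b h ≫ p = b
  app_comp : ∀ {Z Z' : E} (z : Z' ⟶ Z) (t : Z ⟶ T) (b : Z ⟶ B) (h : b ≫ g = t ≫ a)
    (h' : (z ≫ b) ≫ g = (z ≫ t) ≫ a), z ≫ app t b h = app (z ≫ t) (z ≫ b) h'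

namespace LocalSection

variable {g : B ⟶ A} {p : X ⟶ B} {T : E} {a : T ⟶ A}

@[ext]
theorem ext {s s' : LocalSection g p a}
    (h : ∀ {Z : E} (t : Z ⟶ T) (b : Z ⟶ B) (h : b ≫ g = t ≫ a), s.app t b h = s'.app t b h) :
    s = s' := by
  cases s
  cases s'
  congr
  funext Z t b hb
  exact h t b hb

theorem app_congr (s : LocalSection g p a) {Z : E} {t t' : Z ⟶ T} (ht : t = t') {b b' : Z ⟶ B}
    (hb : b = b') (h : b ≫ g = t ≫ a) :
    s.app t b h = s.app t' b' (by subst ht hb; exact h) := by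
  subst ht hb
  rfl

/-- The action of a map `m : T' ⟶ T` on elements of shape `T`. -/
@[simps]
def restrict (s : LocalSection g p a) {T' : E} (m : T' ⟶ T) (a' : T' ⟶ A) (ha : m ≫ a = a') :
    LocalSection g p a' where
  app t b h := s.app (t ≫ m) b (by rw [h, ← ha]; simp)
  app_over t b h := s.app_over _ _ _
  app_comp z t b h h' := by
    rw [s.app_comp z (t ≫ m) b _ (by rw [h', ← ha]; simp)]
    exact s.app_congr (by simp) rfl _

/-- Postcomposition with a map over `B`. -/
@[simps]
def map (s : LocalSection g p a) {X' : E} {p' : X' ⟶ B} (w : X ⟶ X') (hw : w ≫ p' = p) :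
    LocalSection g p' a where
  app t b h := s.app t b h ≫ w
  app_over t b h := by rw [Category.assoc, hw, s.app_over]
  app_comp z t b h h' := by rw [← Category.assoc, s.app_comp]

theorem restrict_restrict (s : LocalSection g p a) {T' T'' : E} (m : T' ⟶ T) (a' : T' ⟶ A)
    (ha : m ≫ a = a') (m' : T'' ⟶ T') (a'' : T'' ⟶ A) (ha' : m' ≫ a' = a'') :
    (s.restrict m a' ha).restrict m' a'' ha' =
      s.restrict (m' ≫ m) a'' (by rw [Category.assoc, ha, ha']) := by
  ext Z t b h
  exact s.app_congr (by simp) rfl _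

theorem restrict_map (s : LocalSection g p a) {T' : E} (m : T' ⟶ T) (a' : T' ⟶ A)
    (ha : m ≫ a = a') {X' : E} {p' : X' ⟶ B} (w : X ⟶ X') (hw : w ≫ p' = p) :
    (s.restrict m a' ha).map w hw = (s.map w hw).restrict m a' ha :=
  rfl

/-- A section is universal if it exhibits its shape as the dependent product of `p` along `g`. -/
def IsUniversal {P : E} {q : P ⟶ A} (Φ : LocalSection g p q) : Prop :=
  ∀ {T : E} (a : T ⟶ A) (s : LocalSection g p a),
    ∃! m : T ⟶ P, ∃ h : m ≫ q = a, Φ.restrict m a h = s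

theorem IsUniversal.hom_ext {P : E} {q : P ⟶ A} {Φ : LocalSection g p q}
    (hΦ : Φ.IsUniversal) {T : E} {m m' : T ⟶ P} (a : T ⟶ A) (h : m ≫ q = a) (h' : m' ≫ q = a)
    (e : Φ.restrict m a h = Φ.restrict m' a h') : m = m' :=
  (hΦ a _).unique ⟨h, e⟩ ⟨h', rfl⟩

/-- The section given by a map out of the pullback. -/
@[simps]
def ofHom [HasPullbacksAlong g] {Y : Over A} (k : (Over.pullback g).obj Y ⟶ Over.mk p) :
    LocalSection g p Y.hom where
  app t b h := pullback.lift t b h.symm ≫ k.left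
  app_over t b h := by
    have := Over.w k
    dsimp at this
    rw [Category.assoc, this, pullback.lift_snd]
  app_comp z t b h h' := by
    have : z ≫ pullback.lift t b h.symm = pullback.lift (z ≫ t) (z ≫ b) h'.symm := by
      apply pullback.hom_ext <;> simp
    rw [← Category.assoc]
    exact congrArg (· ≫ k.left) this

theorem ofHom_injective [HasPullbacksAlong g] {Y : Over A} :
    Function.Injective
      (ofHom : ((Over.pullback g).obj Y ⟶ Over.mk p) → LocalSection g p Y.hom) := by
  intro k k' e
  ext1
  have := congrArg (fun s => s.app (pullback.fst Y.hom g) (pullback.snd Y.hom g)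
    pullback.condition.symm) e
  simpa using this

theorem ofHom_surjective [HasPullbacksAlong g] {Y : Over A} (s : LocalSection g p Y.hom) :
    ∃ k : (Over.pullback g).obj Y ⟶ Over.mk p, ofHom k = s := by
  refine ⟨Over.homMk (s.app (pullback.fst Y.hom g) (pullback.snd Y.hom g)
    pullback.condition.symm) (s.app_over _ _ _), ?_⟩
  ext Z t b h
  have h₁ : pullback.lift t b h.symm ≫ pullback.fst Y.hom g = t := pullback.lift_fst _ _ _
  have h₂ : pullback.lift t b h.symm ≫ pullback.snd Y.hom g = b := pullback.lift_snd _ _ _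
  exact (s.app_comp _ _ _ _ (by rw [h₁, h₂, h])).trans (s.app_congr h₁ h₂ _)

theorem ofHom_comp [HasPullbacksAlong g] {Y Y' : Over A}
    (k : (Over.pullback g).obj Y ⟶ Over.mk p) (m : Y' ⟶ Y) :
    ofHom ((Over.pullback g).map m ≫ k) = (ofHom k).restrict m.left _ (Over.w m) := by
  ext Z t b h
  have : pullback.lift t b h.symm ≫ pullback.lift (f := Y.hom) (g := g)
      (pullback.fst Y'.hom g ≫ m.left)
      (pullback.snd Y'.hom g) (by simp [pullback.condition]) =
      pullback.lift (t ≫ m.left) b (by simp [h]) := by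
    apply pullback.hom_ext <;> simp
  simp only [ofHom_app, restrict_app, Over.comp_left]
  rw [← Category.assoc]
  exact congrArg (· ≫ k.left) this

theorem exists_isUniversal (hg : IsPowerful g) (p : X ⟶ B) :
    ∃ (P : E) (q : P ⟶ A) (Φ : LocalSection g p q), Φ.IsUniversal := by
  obtain ⟨_, _⟩ := hg
  let adj := Adjunction.ofIsLeftAdjoint (Over.pullback g)
  have hpi := isPi_counit adj (Over.mk p)
  refine ⟨_, _, ofHom (adj.counit.app (Over.mk p)), fun {T} a s => ?_⟩
  obtain ⟨k, hk⟩ := ofHom_surjective (Y := Over.mk a) s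
  obtain ⟨m, hm⟩ := (hpi (Over.mk a)).2 k
  refine ⟨m.left, ⟨Over.w m, ?_⟩, ?_⟩
  · rw [← hk, ← hm]
    exact (ofHom_comp _ _).symm
  · rintro m' ⟨h, h'⟩
    have : Over.homMk (U := Over.mk a) m' h = m := by
      refine (hpi (Over.mk a)).1 (ofHom_injective ?_)
      rw [hm, hk, ofHom_comp]
      exact h'
    rw [← this]
    rfl

end LocalSection

end LocalSection

/-! ### Dependent products by induction on a degree -/

section Degree

variable {C : Type u} [Category.{v} C]

/-- The full subcategory of `c/C` on the maps to objects of lower degree than `c`. -/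
abbrev Lower (deg : C → ℕ) (c : C) : Type (max u v) :=
  ObjectProperty.FullSubcategory (fun k : Under c => deg k.right < deg c)

/-- The projection of the lower slice. -/
abbrev Lower.proj (deg : C → ℕ) (c : C) : Lower deg c ⥤ C :=
  ObjectProperty.ι _ ⋙ Under.forget c

variable {E : Type u₁} [Category.{v₁} E] {A B X : C ⥤ E}

/-- All maps either lower the degree or preserve it and are sent to isomorphisms by `f`. -/
def DegreeCompatible (deg : C → ℕ) (_f : B ⟶ A) : Prop :=
  ∀ {c d : C} (k : c ⟶ d), deg d < deg c ∨ (deg d = deg c ∧ IsIso (A.map k) ∧ IsIso (B.map k))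

variable (f : B ⟶ A) (p : X ⟶ B) (deg : C → ℕ)

/-- A compatible family on all maps lowering the degree. -/
structure LowerFamily (c : C) {T : E} (a : T ⟶ A.obj c) where
  /-- the restriction to a map lowering the degree -/
  fam : ∀ k : Lower deg c, Family f p k.obj.right (a ≫ A.map k.obj.hom)
  reindex_fam : ∀ {k k' : Lower deg c} (l : k ⟶ k'),
    (fam k).reindex l.hom.right _ (by rw [Category.assoc, ← A.map_comp, Under.w]) = fam k'

variable {f p deg}

/-- The value of a family at the identity. -/
@[simps]
def Family.base {c : C} {T : E} {a : T ⟶ A.obj c} (φ : Family f p c a) :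
    LocalSection (f.app c) (p.app c) a where
  app t b h := φ.app t (𝟙 c) b (by simpa using h)
  app_over t b h := φ.app_over _ _ _ _
  app_comp z t b h h' := φ.app_comp _ _ _ _ _ _

variable (deg) in
/-- The restriction of a family to all maps lowering the degree. -/
@[simps]
def Family.lower {c : C} {T : E} {a : T ⟶ A.obj c} (φ : Family f p c a) :
    LowerFamily f p deg c a where
  fam k := φ.reindex k.obj.hom _ rfl
  reindex_fam {k k'} l := by
    rw [φ.reindex_reindex]
    ext Z t d j b h
    exact φ.app_congr rfl (by simp) rfl _

namespace LowerFamily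

variable {c : C} {T : E} {a : T ⟶ A.obj c}

@[ext]
theorem ext {ψ ψ' : LowerFamily f p deg c a} (h : ∀ k, ψ.fam k = ψ'.fam k) : ψ = ψ' := by
  cases ψ
  cases ψ'
  congr
  funext k
  exact h k

/-- The action of a map `m : T' ⟶ T` on elements of shape `T`. -/
@[simps]
def restrict (ψ : LowerFamily f p deg c a) {T' : E} (m : T' ⟶ T) (a' : T' ⟶ A.obj c)
    (ha : m ≫ a = a') : LowerFamily f p deg c a' where
  fam k := (ψ.fam k).restrict m _ (by rw [← ha, Category.assoc])
  reindex_fam {k k'} l := by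
    rw [← ψ.reindex_fam l]
    ext
    rfl

/-- A section at `c` and a family on the maps lowering the degree are compatible. -/
def Compatible (ψ : LowerFamily f p deg c a) (s : LocalSection (f.app c) (p.app c) a) : Prop :=
  ∀ (k : Lower deg c) {Z : E} (t : Z ⟶ T) (b : Z ⟶ B.obj c) (h : b ≫ f.app c = t ≫ a),
    s.app t b h ≫ X.map k.obj.hom =
      (ψ.fam k).app t (𝟙 _) (b ≫ B.map k.obj.hom) (by simp [reassoc_of% h])

/-- On a degree-lowering `k` the value is that of `ψ`. On any other `k`, the map `B.map k` is
invertible, so `b` is carried back to `B.obj c`, the section is applied there and the result is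
pushed along `X.map k`. No invertibility of `X.map k` is needed. -/
theorem exists_family (hdeg : DegreeCompatible deg f) {ψ : LowerFamily f p deg c a}
    {s : LocalSection (f.app c) (p.app c) a} (h : ψ.Compatible s) :
    ∃ φ : Family f p c a, φ.base = s ∧ φ.lower deg = ψ := by
  classical
  have hB : ∀ {d e : C} (k : d ⟶ e), ¬ deg e < deg d → IsIso (B.map k) := fun k hk =>
    ((hdeg k).resolve_left hk).2.2
  have hA : ∀ {d e : C} (k : d ⟶ e), ¬ deg e < deg d → IsIso (A.map k) := fun k hk =>
    ((hdeg k).resolve_left hk).2.1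
  have hinv : ∀ {d : C} (k : c ⟶ d) (hk : ¬ deg d < deg c) {Z : E} (t : Z ⟶ T)
      (b : Z ⟶ B.obj d) (_ : b ≫ f.app d = t ≫ a ≫ A.map k),
      (b ≫ (haveI := hB k hk; inv (B.map k))) ≫ f.app c = t ≫ a := fun {d} k hk Z t b e => by
    have := hB k hk
    have := hA k hk
    rw [← cancel_mono (A.map k), Category.assoc, Category.assoc, ← f.naturality,
      IsIso.inv_hom_id_assoc, e, Category.assoc]
  let app : ∀ {Z : E} (t : Z ⟶ T) {d : C} (k : c ⟶ d) (b : Z ⟶ B.obj d),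
      b ≫ f.app d = t ≫ a ≫ A.map k → (Z ⟶ X.obj d) := fun {Z} t {d} k b e =>
    if hk : deg d < deg c then
      (ψ.fam ⟨Under.mk k, hk⟩).app t (𝟙 d) b (by simpa using e)
    else
      s.app t (b ≫ (haveI := hB k hk; inv (B.map k))) (hinv k hk t b e) ≫ X.map k
  have app_pos : ∀ {Z : E} (t : Z ⟶ T) {d : C} (k : c ⟶ d) (b : Z ⟶ B.obj d)
      (e : b ≫ f.app d = t ≫ a ≫ A.map k) (hk : deg d < deg c), app t k b e =
      (ψ.fam ⟨Under.mk k, hk⟩).app t (𝟙 d) b (by simpa using e) := fun t d k b e hk => dif_pos hk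
  have app_neg : ∀ {Z : E} (t : Z ⟶ T) {d : C} (k : c ⟶ d) (b : Z ⟶ B.obj d)
      (e : b ≫ f.app d = t ≫ a ≫ A.map k) (hk : ¬ deg d < deg c), app t k b e =
      s.app t (b ≫ (haveI := hB k hk; inv (B.map k))) (hinv k hk t b e) ≫ X.map k :=
    fun t d k b e hk => dif_neg hk
  refine ⟨⟨app, ?_, ?_, ?_⟩, ?_, ?_⟩
  · intro Z t d k b e
    by_cases hk : deg d < deg c
    · rw [app_pos t k b e hk, Family.app_over]
    · have := hB k hk
      rw [app_neg t k b e hk, Category.assoc, p.naturality, reassoc_of% s.app_over]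
      simp
  · intro Z Z' z t d k b e e'
    by_cases hk : deg d < deg c
    · rw [app_pos t k b e hk, app_pos _ k _ e' hk, Family.app_comp]
    · have := hB k hk
      rw [app_neg t k b e hk, app_neg _ k _ e' hk, ← Category.assoc,
        s.app_comp _ _ _ _ (by simpa using hinv k hk _ _ e')]
      congr 1
      exact s.app_congr rfl (by simp) _
  · intro Z t d d' k l b e e'
    by_cases hk : deg d < deg c
    · have hl : deg d' < deg c := by
        rcases hdeg l with h | h
        · exact h.trans hk
        · rw [h.1]; exact hk
      rw [app_pos t k b e hk, app_pos t (k ≫ l) _ e' hl, Family.app_map _ _ _ _ _ _ (by simpa using e')]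
      let l' : (⟨Under.mk k, hk⟩ : Lower deg c) ⟶ ⟨Under.mk (k ≫ l), hl⟩ :=
        ObjectProperty.homMk (Under.homMk l)
      rw [← ψ.reindex_fam l']
      exact Family.app_congr _ rfl (by simp [l']) rfl _
    · have := hB k hk
      by_cases hl : deg d' < deg c
      -- The mixed case, where `k` preserves the degree and `k ≫ l` lowers it: the two clauses of
      -- the definition meet, and agree by compatibility.
      · rw [app_neg t k b e hk, app_pos t (k ≫ l) _ e' hl, Category.assoc, ← X.map_comp]
        refine (h ⟨Under.mk (k ≫ l), hl⟩ t _ (hinv k hk t b e)).trans ?_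
        exact Family.app_congr _ rfl rfl (by simp) _
      · have hl' : ¬ deg d' < deg d := by
          rw [((hdeg k).resolve_left hk).1]
          exact hl
        have := hB l hl'
        rw [app_neg t k b e hk, app_neg t (k ≫ l) _ e' hl, Category.assoc, X.map_comp]
        congr 1
        exact s.app_congr rfl (by simp) _
  · ext Z t b e
    have hk : ¬ deg c < deg c := lt_irrefl _
    refine (app_neg t (𝟙 c) b (by simpa using e) hk).trans ?_
    rw [X.map_id, Category.comp_id]
    exact s.app_congr rfl (by simp) _
  · ext k Z t d l b e
    have hl : deg d < deg c := by
      rcases hdeg l with h | h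
      · exact h.trans k.property
      · rw [h.1]; exact k.property
    refine (app_pos t (k.obj.hom ≫ l) b (by simpa using e) hl).trans ?_
    let l' : k ⟶ (⟨Under.mk (k.obj.hom ≫ l), hl⟩ : Lower deg c) :=
      ObjectProperty.homMk (Under.homMk l)
    rw [← ψ.reindex_fam l']
    exact Family.app_congr _ rfl (Category.comp_id l) rfl _

/-- A family on the maps lowering the degree is universal if it represents such families. -/
def IsUniversal {P : E} {q : P ⟶ A.obj c} (Ψ : LowerFamily f p deg c q) : Prop :=
  ∀ {T : E} (a : T ⟶ A.obj c) (ψ : LowerFamily f p deg c a),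
    ∃! m : T ⟶ P, ∃ h : m ≫ q = a, Ψ.restrict m a h = ψ

end LowerFamily

theorem Family.compatible {c : C} {T : E} {a : T ⟶ A.obj c} (φ : Family f p c a) :
    (φ.lower deg).Compatible φ.base := fun k Z t b h => by
  refine (φ.app_map t (𝟙 c) k.obj.hom b _ (by simp [reassoc_of% h])).trans ?_
  exact φ.app_congr rfl (by simp) rfl _

/-- For a degree-preserving `k` every `b` is the image under `B.map k` of an element over `c`, so
`app_map` computes the value at `k` from the value at the identity. -/
theorem Family.ext_of_degreeCompatible (hdeg : DegreeCompatible deg f) {c : C} {T : E}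
    {a : T ⟶ A.obj c} {φ φ' : Family f p c a} (h : φ.base = φ'.base)
    (h' : φ.lower deg = φ'.lower deg) : φ = φ' := by
  ext Z t d k b e
  rcases hdeg k with hk | ⟨-, _, _⟩
  · have := congrArg (fun ψ => (ψ.fam ⟨Under.mk k, hk⟩).app t (𝟙 d) b (by simpa using e)) h'
    exact (φ.app_congr rfl (by simp) rfl _).trans (this.trans (φ'.app_congr rfl (by simp) rfl _))
  · have e' : (b ≫ inv (B.map k)) ≫ f.app c = t ≫ a := by
      rw [← cancel_mono (A.map k), Category.assoc, Category.assoc, ← f.naturality,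
        IsIso.inv_hom_id_assoc, e, Category.assoc]
    have := congrArg (fun s => s.app t (b ≫ inv (B.map k)) e' ≫ X.map k) h
    simp only [Family.base_app] at this
    rw [φ.app_map _ _ _ _ _ (by simp [e]), φ'.app_map _ _ _ _ _ (by simp [e])] at this
    exact (φ.app_congr rfl (by simp) (by simp) _).trans
      (this.trans (φ'.app_congr rfl (by simp) (by simp) _))

/-! #### The inductive construction -/

section LowerLimit

variable (deg) (c : C) [HasLimitsOfShape (Lower deg c) E] (F : C ⥤ E)

/-- The limit of a functor over the lower slice. -/
def lowerLimit : E :=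
  limit (Lower.proj deg c ⋙ F)

variable {deg c}

/-- The projections of the limit over the lower slice. -/
def lowerLimitπ (k : Lower deg c) : lowerLimit deg c F ⟶ F.obj k.obj.right :=
  limit.π (Lower.proj deg c ⋙ F) k

theorem lowerLimit_hom_ext {F : C ⥤ E} {T : E} {m m' : T ⟶ lowerLimit deg c F}
    (h : ∀ k, m ≫ lowerLimitπ F k = m' ≫ lowerLimitπ F k) : m = m' :=
  limit.hom_ext h

theorem lowerLimitπ_map {k k' : Lower deg c} (l : k ⟶ k') :
    lowerLimitπ F k ≫ F.map l.hom.right = lowerLimitπ F k' :=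
  limit.w (Lower.proj deg c ⋙ F) l

/-- The universal property of the limit over the lower slice. -/
def lowerLimitLift {F : C ⥤ E} {T : E} (x : ∀ k : Lower deg c, T ⟶ F.obj k.obj.right)
    (hx : ∀ (k k' : Lower deg c) (l : k ⟶ k'), x k ≫ F.map l.hom.right = x k') :
    T ⟶ lowerLimit deg c F :=
  limit.lift (Lower.proj deg c ⋙ F)
    { pt := T
      π := { app := x, naturality := fun k k' l => (Category.id_comp _).trans (hx k k' l).symm } }

@[simp]
theorem lowerLimitLift_π {F : C ⥤ E} {T : E} (x : ∀ k : Lower deg c, T ⟶ F.obj k.obj.right)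
    (hx : ∀ (k k' : Lower deg c) (l : k ⟶ k'), x k ≫ F.map l.hom.right = x k')
    (k : Lower deg c) : lowerLimitLift x hx ≫ lowerLimitπ F k = x k :=
  limit.lift_π _ _

@[simp]
theorem lowerLimitLift_π_assoc {F : C ⥤ E} {T : E} (x : ∀ k : Lower deg c, T ⟶ F.obj k.obj.right)
    (hx : ∀ (k k' : Lower deg c) (l : k ⟶ k'), x k ≫ F.map l.hom.right = x k')
    (k : Lower deg c) {Z : E} (z : F.obj k.obj.right ⟶ Z) :
    lowerLimitLift x hx ≫ lowerLimitπ F k ≫ z = x k ≫ z := by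
  rw [← Category.assoc, lowerLimitLift_π]

variable (deg c)

/-- The map from the value of a functor to its limit over the lower slice. -/
def lowerMap : F.obj c ⟶ lowerLimit deg c F :=
  lowerLimitLift (fun k => F.map k.obj.hom) fun k k' l => by
    rw [← F.map_comp, Under.w]

@[simp]
theorem lowerMap_π (k : Lower deg c) :
    lowerMap deg c F ≫ lowerLimitπ F k = F.map k.obj.hom :=
  lowerLimitLift_π (fun k => F.map k.obj.hom) _ k

@[simp]
theorem lowerMap_π_assoc (k : Lower deg c) {Z : E} (z : F.obj k.obj.right ⟶ Z) :
    lowerMap deg c F ≫ lowerLimitπ F k ≫ z = F.map k.obj.hom ≫ z :=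
  lowerLimitLift_π_assoc (fun k => F.map k.obj.hom) _ k z

variable {F}

/-- Functoriality of the limit over the lower slice. -/
def lowerLimitMap {G : C ⥤ E} (p : F ⟶ G) : lowerLimit deg c F ⟶ lowerLimit deg c G :=
  lowerLimitLift (fun k => lowerLimitπ F k ≫ p.app _) fun k k' l => by
    rw [Category.assoc, ← p.naturality, reassoc_of% lowerLimitπ_map F l]

@[simp]
theorem lowerLimitMap_π {G : C ⥤ E} (p : F ⟶ G) (k : Lower deg c) :
    lowerLimitMap deg c p ≫ lowerLimitπ G k = lowerLimitπ F k ≫ p.app _ :=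
  lowerLimitLift_π (fun k => lowerLimitπ F k ≫ p.app _) _ k

end LowerLimit

/-- A lower family amounts to a compatible system of points of the dependent products `Y.obj k`,
that is, a point of `limit Y`, lying over the image of `a` in the limit of `A`. Hence the pullback
of `limit Y` along `lowerMap deg c A`. -/
theorem LowerFamily.exists_isUniversal [HasPullbacks E] {c : C}
    [HasLimitsOfShape (Lower deg c) E]
    (h : ∀ d, deg d < deg c → RepresentableAt f p d) :
    ∃ (P : E) (q : P ⟶ A.obj c) (Ψ : LowerFamily f p deg c q), Ψ.IsUniversal := by
  obtain ⟨Y, q, hq, Φ, hΦ, hY⟩ : ∃ (Y : Lower deg c ⥤ E)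
      (q : ∀ k : Lower deg c, Y.obj k ⟶ A.obj k.obj.right)
      (hq : ∀ {k k' : Lower deg c} (l : k ⟶ k'), Y.map l ≫ q k' = q k ≫ A.map l.hom.right)
      (Φ : ∀ k : Lower deg c, Family f p k.obj.right (q k)), (∀ k, (Φ k).IsUniversal) ∧
      ∀ {k k'} (l : k ⟶ k'), (Φ k').restrict (Y.map l) _ (hq l) =
        (Φ k).reindex l.hom.right _ rfl := by
    obtain ⟨Y, q, Φ, hΦ, hY⟩ :=
      exists_functor_of_representableAt (Lower.proj deg c) fun k => h _ k.property
    exact ⟨Y, fun k => q.app k, fun l => q.naturality l, Φ, hΦ, hY⟩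
  let w : limit Y ⟶ lowerLimit deg c A := lowerLimitLift (fun k => limit.π Y k ≫ q k) fun k k' l => by
    rw [Category.assoc, ← hq l, limit.w_assoc]
  have hw : ∀ k, w ≫ lowerLimitπ A k = limit.π Y k ≫ q k := fun k => lowerLimitLift_π _ _ k
  have hP : ∀ k, (pullback.fst w (lowerMap deg c A) ≫ limit.π Y k) ≫ q k =
      pullback.snd w (lowerMap deg c A) ≫ A.map k.obj.hom := fun k => by
    rw [Category.assoc, ← lowerMap_π, ← hw, pullback.condition_assoc]
  refine ⟨pullback w (lowerMap deg c A), pullback.snd _ _,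
    ⟨fun k => (Φ k).restrict (pullback.fst _ _ ≫ limit.π Y k) _ (hP k), 
      fun {k k'} l => ?_⟩, fun {T} a ψ => ?_⟩
  · rw [Family.restrict_reindex _ _ _ _ _ _ rfl, ← hY l, Family.restrict_restrict]
    congr 1
    simp
  · choose m hm hm' using fun k => (hΦ k _ (ψ.fam k)).exists
    have hm'' : ∀ {k k'} (l : k ⟶ k'), m k ≫ Y.map l = m k' := fun {k k'} l => by
      have ha : (m k ≫ Y.map l) ≫ q k' = a ≫ A.map k'.obj.hom := by
        rw [Category.assoc, hq, reassoc_of% hm k, ← A.map_comp, Under.w]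
      refine Family.IsUniversal.hom_ext (hΦ k') _ ha (hm k') ?_
      rw [hm', ← ψ.reindex_fam l, ← hm' k, Family.restrict_reindex _ _ _ _ _ _ rfl, ← hY l,
        Family.restrict_restrict]
    let M : T ⟶ limit Y := limit.lift Y
      ⟨T, ⟨m, fun k k' l => (Category.id_comp _).trans (hm'' l).symm⟩⟩
    have hM : ∀ k, M ≫ limit.π Y k = m k := fun k => limit.lift_π _ _
    refine ⟨pullback.lift M a ?_, ⟨pullback.lift_snd _ _ _, ?_⟩, ?_⟩
    · apply lowerLimit_hom_ext
      intro k
      rw [Category.assoc, hw, reassoc_of% hM, hm, Category.assoc, lowerMap_π]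
    · ext1 k
      rw [LowerFamily.restrict_fam]
      rw [Family.restrict_restrict, ← hm' k]
      congr 1
      simp [hM]
    · rintro m' ⟨h, h'⟩
      apply pullback.hom_ext
      · apply limit.hom_ext
        intro k
        rw [pullback.lift_fst, hM, Category.assoc]
        refine Family.IsUniversal.hom_ext (hΦ k) (a ≫ A.map k.obj.hom) ?_ (hm k) ?_
        · rw [Category.assoc, hP, reassoc_of% h]
        · rw [hm', ← h', LowerFamily.restrict_fam]
          rw [Family.restrict_restrict]
      · rw [pullback.lift_snd, h]

/-! ### The relative matching object and the gluing step -/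

section

variable [HasPullbacks E] {c : C} [HasLimitsOfShape (Lower deg c) E]

variable (deg) in
/-- The relative matching map of `p`. -/
def relLowerMap (c : C) [HasLimitsOfShape (Lower deg c) E] (p : X ⟶ B) :
    X.obj c ⟶ pullback (lowerLimitMap deg c p) (lowerMap deg c B) :=
  pullback.lift (lowerMap deg c X) (p.app c) (by
    apply lowerLimit_hom_ext
    intro k
    simp)

theorem relLowerMap_snd : relLowerMap deg c p ≫ pullback.snd _ _ = p.app c :=
  pullback.lift_snd _ _ _

theorem relLowerMap_fst_π (k : Lower deg c) :
    relLowerMap deg c p ≫ pullback.fst _ _ ≫ lowerLimitπ X k = X.map k.obj.hom := by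
  simp [relLowerMap]

variable {T : E} {a : T ⟶ A.obj c}

/-- The section of the relative matching object given by a family on the maps lowering the
degree. -/
def LowerFamily.matchingSection (ψ : LowerFamily f p deg c a) :
    LocalSection (f.app c)
      (pullback.snd (lowerLimitMap deg c p) (lowerMap deg c B)) a where
  app {Z} t b h := pullback.lift
    (lowerLimitLift (fun k => (ψ.fam k).app t (𝟙 _) (b ≫ B.map k.obj.hom) (by
        simp [reassoc_of% h])) fun k k' l => by
      have e : (b ≫ B.map k.obj.hom) ≫ B.map l.hom.right = b ≫ B.map k'.obj.hom := by
        rw [Category.assoc, ← B.map_comp, Under.w]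
      rw [Family.app_map _ _ _ _ _ _ (by
        rw [e]
        simp [reassoc_of% h, ← A.map_comp]), ← ψ.reindex_fam l]
      exact Family.app_congr _ rfl (by simp) e _) b (by
        apply lowerLimit_hom_ext
        intro k
        simp [Family.app_over])
  app_over t b h := pullback.lift_snd _ _ _
  app_comp z t b h h' := by
    apply pullback.hom_ext
    · apply lowerLimit_hom_ext
      intro k
      simp only [Category.assoc, pullback.lift_fst, lowerLimitLift_π]
      refine (Family.app_comp _ _ _ _ _ _ ?_).trans
        (Family.app_congr _ rfl rfl ?_ _)
      · simp [reassoc_of% h]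
      · simp
    · simp

/-- Sections of the relative matching object already agree in `B.obj c`, so their equality is tested
on the projections to `X`, which is compatibility. This turns compatibility into an equation between
maps to a representing object. -/
theorem LowerFamily.compatible_iff {ψ : LowerFamily f p deg c a}
    {s : LocalSection (f.app c) (p.app c) a} :
    ψ.Compatible s ↔ s.map (relLowerMap deg c p) relLowerMap_snd = ψ.matchingSection := by
  have hψ : ∀ (k : Lower deg c) {Z : E} (t : Z ⟶ T) (b : Z ⟶ B.obj c)
      (e : b ≫ f.app c = t ≫ a), ψ.matchingSection.app t b e ≫ pullback.fst _ _ ≫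
        lowerLimitπ X k = (ψ.fam k).app t (𝟙 _) (b ≫ B.map k.obj.hom)
          (by simp [reassoc_of% e]) := fun k Z t b e => by
    simp [LowerFamily.matchingSection]
  constructor
  · intro h
    refine LocalSection.ext fun {Z} t b e => pullback.hom_ext ?_ ?_
    · refine lowerLimit_hom_ext fun k => ?_
      rw [Category.assoc, Category.assoc, hψ, LocalSection.map_app, Category.assoc,
        relLowerMap_fst_π]
      exact h k t b e
    · rw [LocalSection.map_app, Category.assoc, relLowerMap_snd, s.app_over,
        ψ.matchingSection.app_over]
  · intro h k Z t b e
    have := congrArg (fun s => s.app t b e ≫ pullback.fst _ _ ≫ lowerLimitπ X k) h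
    rwa [hψ, LocalSection.map_app, Category.assoc, relLowerMap_fst_π] at this

theorem LowerFamily.matchingSection_restrict (ψ : LowerFamily f p deg c a) {T' : E} (m : T' ⟶ T)
    (a' : T' ⟶ A.obj c) (ha : m ≫ a = a') :
    (ψ.restrict m a' ha).matchingSection = ψ.matchingSection.restrict m a' ha :=
  rfl

end

/-- Families at `c` are the fibre product of sections of `p.app c` and lower families over sections
of the relative matching object. These three functors are represented over `A.obj c` by `R`, `H` and
`R'`, so families are represented by a pullback. -/
theorem representableAt_of_lower [HasPullbacks E] (hdeg : DegreeCompatible deg f) {c : C}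
    [HasLimitsOfShape (Lower deg c) E] (hf : IsPowerful (f.app c))
    (h : ∀ d, deg d < deg c → RepresentableAt f p d) : RepresentableAt f p c := by
  obtain ⟨H, qH, Ψ, hΨ⟩ := LowerFamily.exists_isUniversal h
  obtain ⟨R, qR, Φ, hΦ⟩ := LocalSection.exists_isUniversal hf (p.app c)
  obtain ⟨R', qR', Φ', hΦ'⟩ := LocalSection.exists_isUniversal hf
    (pullback.snd (lowerLimitMap deg c p) (lowerMap deg c B))
  -- The maps `r : R ⟶ R'` and `s : H ⟶ R'` classify the two ways of producing a section of the
  -- relative matching object.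
  obtain ⟨r, hr, er⟩ :=
    (hΦ' qR (Φ.map (relLowerMap deg c p) relLowerMap_snd)).exists
  obtain ⟨s, hs, es⟩ := (hΦ' qH Ψ.matchingSection).exists
  have hq : pullback.snd r s ≫ qH = pullback.fst r s ≫ qR := by
    rw [← hr, ← hs, pullback.condition_assoc]
  -- The generic section and the generic lower family become compatible on the pullback, so they
  -- glue to the candidate universal family.
  obtain ⟨Ω, hΩ, hΩ'⟩ := LowerFamily.exists_family hdeg
    (ψ := Ψ.restrict (pullback.snd r s) _ hq) (s := Φ.restrict (pullback.fst r s) _ rfl) (by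
      rw [LowerFamily.compatible_iff, LocalSection.restrict_map,
        LowerFamily.matchingSection_restrict, ← er, ← es, LocalSection.restrict_restrict,
        LocalSection.restrict_restrict]
      congr 1
      exact pullback.condition)
  have hbase : ∀ {T : E} (m : T ⟶ pullback r s) (a) (ha), (Ω.restrict m a ha).base =
      Φ.restrict (m ≫ pullback.fst r s) a (by simpa using ha) := fun m a ha => by
    refine Eq.trans ?_ (LocalSection.restrict_restrict Φ _ _ rfl _ _ ha)
    rw [← hΩ]
    rfl
  have hlower : ∀ {T : E} (m : T ⟶ pullback r s) (a) (ha), (Ω.restrict m a ha).lower deg =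
      Ψ.restrict (m ≫ pullback.snd r s) a (by simpa [hq] using ha) := fun m a ha => by
    have : (Ω.restrict m a ha).lower deg = (Ω.lower deg).restrict m a ha := rfl
    rw [this, hΩ']
    ext1 k
    rw [LowerFamily.restrict_fam, LowerFamily.restrict_fam, LowerFamily.restrict_fam,
      Family.restrict_restrict]
  refine ⟨_, _, Ω, fun {T} a ψ => ?_⟩
  obtain ⟨m₁, ⟨h₁, e₁⟩, u₁⟩ := hΦ a ψ.base
  obtain ⟨m₂, ⟨h₂, e₂⟩, u₂⟩ := hΨ a (ψ.lower deg)
  have hm : m₁ ≫ r = m₂ ≫ s := by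
    refine hΦ'.hom_ext a (by simp [hr, h₁]) (by simp [hs, h₂]) ?_
    rw [← LocalSection.restrict_restrict _ r _ hr _ _ h₁,
      ← LocalSection.restrict_restrict _ s _ hs _ _ h₂, er, es, ← LocalSection.restrict_map,
      ← LowerFamily.matchingSection_restrict, ← LowerFamily.compatible_iff, e₁, e₂]
    exact ψ.compatible
  refine ⟨pullback.lift m₁ m₂ hm, ⟨by simp [h₁], ?_⟩, ?_⟩
  · refine Family.ext_of_degreeCompatible hdeg ?_ ?_
    · rw [hbase, ← e₁]
      congr 1
      simp
    · rw [hlower, ← e₂]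
      congr 1
      simp
  · rintro m ⟨ha, e⟩
    apply pullback.hom_ext
    · rw [pullback.lift_fst]
      refine u₁ _ ⟨by simpa using ha, ?_⟩
      rw [← hbase m a ha, e]
    · rw [pullback.lift_snd]
      refine u₂ _ ⟨by simpa [hq] using ha, ?_⟩
      rw [← hlower m a ha, e]

theorem representableAt_of_degreeCompatible [HasPullbacks E] (hdeg : DegreeCompatible deg f)
    [∀ c, HasLimitsOfShape (Lower deg c) E] (hf : ∀ c, IsPowerful (f.app c)) (c : C) :
    RepresentableAt f p c := by
  induction hn : deg c using Nat.strong_induction_on generalizing c with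
  | _ n ih =>
    subst hn
    exact representableAt_of_lower hdeg (hf c) fun d hd => ih _ hd d rfl

end Degree

/-! ### Change of the indexing category -/

section Along

variable {J : Type u} [Category.{v} J] {H : Type u₂} [Category.{v₂} H] (γ : J ⥤ H)
  {E : Type u₁} [Category.{v₁} E] {A B X : H ⥤ E} {f : B ⟶ A} {p : X ⟶ B}

/-- Restriction of a family along a functor. -/
@[simps]
def Family.along {c : J} {T : E} {a : T ⟶ A.obj (γ.obj c)} (φ : Family f p (γ.obj c) a) :
    Family (A := γ ⋙ A) (Functor.whiskerLeft γ f) (Functor.whiskerLeft γ p) c a where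
  app t _ k b h := φ.app t (γ.map k) b h
  app_over t _ k b h := φ.app_over t (γ.map k) b h
  app_comp z t _ k b h h' := φ.app_comp z t (γ.map k) b h h'
  app_map t _ _ k l b h h' := by
    have e : (b ≫ B.map (γ.map l)) ≫ f.app _ = t ≫ a ≫ A.map (γ.map k ≫ γ.map l) := by
      rw [← γ.map_comp]
      exact h'
    exact (φ.app_map t (γ.map k) (γ.map l) b h e).trans
      (φ.app_congr rfl (γ.map_comp k l).symm rfl e)

theorem Family.along_reindex {c : J} {T : E} {a : T ⟶ A.obj (γ.obj c)}
    (φ : Family f p (γ.obj c) a) {d : J} (k : c ⟶ d) (a' : T ⟶ A.obj (γ.obj d))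
    (h : a ≫ A.map (γ.map k) = a') :
    (φ.along γ).reindex k a' h = (φ.reindex (γ.map k) a' h).along γ := by
  ext Z t e l b h
  exact φ.app_congr rfl (γ.map_comp k l) rfl _

/-- Restriction of an evaluation along a functor. -/
@[simps]
def Evaluation.along {Y : H ⥤ E} {q : Y ⟶ A} (ev : Evaluation f p q) :
    Evaluation (Functor.whiskerLeft γ f) (Functor.whiskerLeft γ p) (Functor.whiskerLeft γ q) where
  app {_ d} y b h := ev.app (d := γ.obj d) y b h
  app_over {_ d} y b h := ev.app_over (d := γ.obj d) y b h
  app_comp {_ _} z {d} y b h h' := ev.app_comp (d := γ.obj d) z y b h h'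
  app_map l y b h h' := ev.app_map (γ.map l) y b h h'

theorem DegreeCompatible.along {deg : H → ℕ} (h : DegreeCompatible deg f) :
    DegreeCompatible (deg ∘ γ.obj) (Functor.whiskerLeft γ f) :=
  fun k => h (γ.map k)

/-- The functor induced by `γ` between lower slices. -/
@[simps]
def Lower.along (deg : H → ℕ) (c : J) : Lower (deg ∘ γ.obj) c ⥤ Lower deg (γ.obj c) where
  obj k := ⟨Under.mk (γ.map k.obj.hom), k.property⟩
  map {k k'} l := ObjectProperty.homMk (Under.homMk (γ.map l.hom.right) (by
    dsimp
    rw [← γ.map_comp, Under.w]))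
  map_id k := by
    ext
    exact γ.map_id _
  map_comp l l' := by
    ext
    exact γ.map_comp _ _

variable {deg : H → ℕ}

variable {γ} in
/-- The map in `H` underlying a map out of the image of the lower slice of `J`. -/
def Lower.alongRight {c : J} {k : Lower deg (γ.obj c)} {x : Lower (deg ∘ γ.obj) c}
    (l : (Lower.along γ deg c).obj x ⟶ k) : γ.obj x.obj.right ⟶ k.obj.right :=
  l.hom.right

variable {γ} in
theorem Lower.map_alongRight {c : J} {k : Lower deg (γ.obj c)} {x : Lower (deg ∘ γ.obj) c}
    (l : (Lower.along γ deg c).obj x ⟶ k) :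
    γ.map x.obj.hom ≫ Lower.alongRight l = k.obj.hom :=
  Under.w l.hom

/-- By induction on the degree. The base is unchanged by restriction. At a lower map `k`, initiality
provides a factorisation of `k` through some `γ.map x.obj.hom`; the induction hypothesis at `x`
gives the member there, and connectedness makes its reindexing to `k` independent of the
factorisation. -/
theorem Family.along_bijective (hdeg : DegreeCompatible deg f)
    (hinit : ∀ c : J, (Lower.along γ deg c).Initial) (c : J) {T : E} (a : T ⟶ A.obj (γ.obj c)) :
    Function.Bijective
      (Family.along γ : Family f p (γ.obj c) a → Family (A := γ ⋙ A) _ _ c a) := by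
  induction hn : deg (γ.obj c) using Nat.strong_induction_on generalizing c with
  | _ n ih =>
    subst hn
    replace ih : ∀ (x : Lower (deg ∘ γ.obj) c) (a : T ⟶ A.obj (γ.obj x.obj.right)),
        Function.Bijective (Family.along γ :
          Family f p (γ.obj x.obj.right) a → Family (A := γ ⋙ A) _ _ x.obj.right a) :=
      fun x a => ih _ x.property x.obj.right a rfl
    have := hinit c
    constructor
    · intro φ φ' e
      refine Family.ext_of_degreeCompatible hdeg ?_ ?_
      · ext Z t b h
        have := congrArg (fun χ => Family.app χ t (𝟙 c) b (by simpa using h)) e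
        exact (φ.app_congr rfl (γ.map_id c).symm rfl _).trans
          (this.trans (φ'.app_congr rfl (γ.map_id c) rfl _))
      · ext1 k
        let x := Functor.Initial.lift (Lower.along γ deg c) k
        let l : (Lower.along γ deg c).obj x ⟶ k := Functor.Initial.homToLift _ k
        have hl : γ.map x.obj.hom ≫ Lower.alongRight l = k.obj.hom := Lower.map_alongRight l
        have hx : φ.reindex (γ.map x.obj.hom) _ rfl = φ'.reindex (γ.map x.obj.hom) _ rfl := by
          refine (ih x _).1 ?_
          refine (φ.along_reindex γ x.obj.hom _ rfl).symm.trans ?_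
          refine Eq.trans ?_ (φ'.along_reindex γ x.obj.hom _ rfl)
          rw [e]
        ext Z t d j b h
        have h' : b ≫ f.app d = t ≫ (a ≫ A.map (γ.map x.obj.hom)) ≫ A.map ((Lower.alongRight l) ≫ j) := by
          rw [h, ← hl]
          simp
        have := congrArg (fun χ => Family.app χ t ((Lower.alongRight l) ≫ j) b h') hx
        exact (φ.app_congr rfl (by rw [← hl, Category.assoc]) rfl _).trans
          (this.trans (φ'.app_congr rfl (by rw [← hl, Category.assoc]) rfl _))
    · intro χ
      -- The members of the lower family at objects coming from `J`, given by the induction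
      -- hypothesis.
      choose ψ hψ using fun x : Lower (deg ∘ γ.obj) c =>
        (ih x (a ≫ A.map (γ.map x.obj.hom))).2 (χ.reindex x.obj.hom _ rfl)
      have hψ' : ∀ {x x' : Lower (deg ∘ γ.obj) c} (j : x ⟶ x'),
          (ψ x).reindex (γ.map j.hom.right) _ (by
            rw [Category.assoc, ← A.map_comp, ← γ.map_comp, Under.w]) = ψ x' := fun {x x'} j => by
        refine (ih x' _).1 ?_
        rw [hψ, ← Family.along_reindex, hψ, Family.reindex_reindex]
        ext Z t d k b h
        exact χ.app_congr rfl (by rw [Under.w]) rfl _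
      have ha : ∀ {k : Lower deg (γ.obj c)} (x : Lower (deg ∘ γ.obj) c)
          (l : (Lower.along γ deg c).obj x ⟶ k),
          (a ≫ A.map (γ.map x.obj.hom)) ≫ A.map (Lower.alongRight l) = a ≫ A.map k.obj.hom :=
        fun x l => by rw [Category.assoc, ← A.map_comp, Lower.map_alongRight]
      -- Any two factorisations of `k` are joined by a zigzag, and each step of it preserves the
      -- reindexed member.
      have hind : ∀ {k : Lower deg (γ.obj c)} (x : Lower (deg ∘ γ.obj) c)
          (l : (Lower.along γ deg c).obj x ⟶ k),
          (ψ (Functor.Initial.lift (Lower.along γ deg c) k)).reindex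
            (Lower.alongRight (Functor.Initial.homToLift (Lower.along γ deg c) k)) _ (ha _ _) =
          (ψ x).reindex (Lower.alongRight l) _ (ha x l) := fun {k} x l => by
        have step : ∀ (x₁ x₂ : Lower (deg ∘ γ.obj) c) (l₁ : (Lower.along γ deg c).obj x₁ ⟶ k)
            (l₂ : (Lower.along γ deg c).obj x₂ ⟶ k) (j : x₁ ⟶ x₂),
            (Lower.along γ deg c).map j ≫ l₂ = l₁ →
            (ψ x₁).reindex (Lower.alongRight l₁) _ (ha x₁ l₁) =
              (ψ x₂).reindex (Lower.alongRight l₂) _ (ha x₂ l₂) := fun x₁ x₂ l₁ l₂ j e => by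
          rw [← hψ' j, Family.reindex_reindex]
          subst e
          rfl
        exact Functor.Initial.induction (Lower.along γ deg c)
          (fun x' l' => (ψ x').reindex (Lower.alongRight l') _ (ha x' l') =
            (ψ x).reindex (Lower.alongRight l) _ (ha x l))
          (fun x₁ x₂ l₁ l₂ j e h => (step x₁ x₂ l₁ l₂ j e).symm.trans h)
          (fun x₁ x₂ l₁ l₂ j e h => (step x₁ x₂ l₁ l₂ j e).trans h) (X₀ := x) (k₀ := l) rfl
      let ψ' : LowerFamily f p deg (γ.obj c) a :=
        { fam := fun k => (ψ (Functor.Initial.lift (Lower.along γ deg c) k)).reindex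
            (Lower.alongRight (Functor.Initial.homToLift (Lower.along γ deg c) k)) _ (ha _ _)
          reindex_fam := fun {k k'} l => by
            rw [Family.reindex_reindex]
            exact (hind _ (Functor.Initial.homToLift (Lower.along γ deg c) k ≫ l)).symm }
      let s : LocalSection (f.app (γ.obj c)) (p.app (γ.obj c)) a := χ.base
      have hs : ψ'.Compatible s := fun k Z t b h => by
        let x := Functor.Initial.lift (Lower.along γ deg c) k
        let l : (Lower.along γ deg c).obj x ⟶ k := Functor.Initial.homToLift _ k
        have hl := Lower.map_alongRight l
        have h₁ : (b ≫ B.map (γ.map x.obj.hom)) ≫ f.app _ =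
            t ≫ (a ≫ A.map (γ.map x.obj.hom)) ≫ A.map (𝟙 _) := by
          simp [reassoc_of% h]
        have h₂ : (b ≫ B.map (γ.map x.obj.hom)) ≫ f.app _ =
            t ≫ a ≫ A.map (γ.map (x.obj.hom ≫ 𝟙 _)) := by
          simp [reassoc_of% h]
        have h₃ : b ≫ f.app _ = t ≫ a ≫ A.map (γ.map (𝟙 c)) := by simp [h]
        -- Compatibility holds at maps coming from `J`, because `χ` is natural there; it is then
        -- carried along `l` to `k`.
        have e₁ : (ψ x).app t (𝟙 _) (b ≫ B.map (γ.map x.obj.hom)) h₁ =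
            χ.app t (𝟙 c) b h₃ ≫ X.map (γ.map x.obj.hom) := by
          have h₅ : (b ≫ B.map (γ.map x.obj.hom)) ≫ f.app _ =
              t ≫ (a ≫ A.map (γ.map x.obj.hom)) ≫ A.map (γ.map (𝟙 _)) := by
            rw [γ.map_id]
            exact h₁
          have e₂ := congrArg (fun φ : Family (A := γ ⋙ A) (Functor.whiskerLeft γ f)
            (Functor.whiskerLeft γ p) x.obj.right (a ≫ A.map (γ.map x.obj.hom)) =>
              φ.app t (𝟙 x.obj.right) (b ≫ B.map (γ.map x.obj.hom)) h₅) (hψ x)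
          refine ((ψ x).app_congr rfl (γ.map_id _).symm rfl h₁).trans (e₂.trans ?_)
          refine Eq.trans ?_ (χ.app_map t (𝟙 c) x.obj.hom b h₃ (by
            simpa using h₂)).symm
          exact χ.app_congr rfl (by simp) rfl _
        have h₄ : ((b ≫ B.map (γ.map x.obj.hom)) ≫ B.map (Lower.alongRight l)) ≫ f.app _ =
            t ≫ (a ≫ A.map (γ.map x.obj.hom)) ≫ A.map (𝟙 _ ≫ (Lower.alongRight l)) := by
          rw [Category.assoc, f.naturality, ← Category.assoc, h₁]
          simp
        refine Eq.trans ?_ (((ψ x).app_map t (𝟙 _) (Lower.alongRight l) _ h₁ h₄).trans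
          ((ψ x).app_congr rfl ((Category.id_comp _).trans (Category.comp_id _).symm) ?_ _))
        · rw [e₁, Category.assoc, ← X.map_comp, hl]
          rfl
        · rw [Category.assoc, ← B.map_comp, hl]
      obtain ⟨φ, hφ, hφ'⟩ := LowerFamily.exists_family hdeg hs
      refine ⟨φ, Family.ext_of_degreeCompatible (hdeg.along γ) ?_ ?_⟩
      · ext Z t b h
        have := congrArg (fun s => LocalSection.app s t b h) hφ
        exact (φ.app_congr rfl (γ.map_id c) rfl _).trans this
      · ext1 x
        refine (φ.along_reindex γ x.obj.hom _ rfl).trans ?_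
        refine Eq.trans ?_ (hψ x)
        refine congrArg (Family.along γ) ?_
        have e₁ := congrArg (fun ψ => LowerFamily.fam ψ ((Lower.along γ deg c).obj x)) hφ'
        refine e₁.trans ((hind x (𝟙 _)).trans ?_)
        exact Family.reindex_id _

theorem Evaluation.PointwiseUniversal.along (hdeg : DegreeCompatible deg f)
    (hinit : ∀ c : J, (Lower.along γ deg c).Initial) {Y : H ⥤ E} {q : Y ⟶ A}
    {ev : Evaluation f p q} (hev : ev.PointwiseUniversal) : (ev.along γ).PointwiseUniversal := by
  intro c T a ψ
  obtain ⟨φ, rfl⟩ := (Family.along_bijective γ hdeg hinit c a).2 ψ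
  obtain ⟨m, ⟨hm, e⟩, huniq⟩ := hev (γ.obj c) a φ
  exact ⟨m, ⟨hm, congrArg (Family.along γ) e⟩, fun m' ⟨hm', e'⟩ =>
    huniq m' ⟨hm', (Family.along_bijective γ hdeg hinit c a).1 e'⟩⟩

variable [HasPullbacks E]

/-- The map on the left is the one whose transpose defines `piComparison`. On generalized elements
the base change isomorphism disappears, because both pullbacks have the same universal property at
each object. -/
theorem Evaluation.ofHom_along {Y : Over A} {X : Over B} (g : (Over.pullback f).obj Y ⟶ X) :
    Evaluation.ofHom (f := ((Functor.whiskeringLeft _ _ E).obj γ).map f)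
      ((baseChangeIso ((Functor.whiskeringLeft _ _ E).obj γ) f).hom.app Y ≫
        (Over.post ((Functor.whiskeringLeft _ _ E).obj γ)).map g) =
      (Evaluation.ofHom g).along γ := by
  ext Z d y b h
  let G := (Functor.whiskeringLeft _ _ E).obj γ
  have h₁ := congrArg (fun k => k.app d) (pullbackComparison_comp_fst G Y.hom f)
  have h₂ := congrArg (fun k => k.app d) (pullbackComparison_comp_snd G Y.hom f)
  have key : ∀ (y : Z ⟶ (G.obj Y.left).obj d) (b : Z ⟶ (G.obj B).obj d)
      (h : y ≫ (G.map Y.hom).app d = b ≫ (G.map f).app d),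
      (isPullback_app (G.map Y.hom) (G.map f) d).lift y b h ≫
        (PreservesPullback.iso G Y.hom f).inv.app d =
      (isPullback_app Y.hom f (γ.obj d)).lift y b h := fun y b h => by
    have : IsIso ((PreservesPullback.iso G Y.hom f).hom.app d) := inferInstance
    rw [← cancel_mono ((PreservesPullback.iso G Y.hom f).hom.app d), Category.assoc,
      ← NatTrans.comp_app, Iso.inv_hom_id, NatTrans.id_app, Category.comp_id]
    apply (isPullback_app (G.map Y.hom) (G.map f) d).hom_ext
    · rw [IsPullback.lift_fst, Category.assoc, PreservesPullback.iso_hom]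
      exact ((congrArg (_ ≫ ·) h₁).trans
        ((isPullback_app Y.hom f (γ.obj d)).lift_fst y b h)).symm
    · rw [IsPullback.lift_snd, Category.assoc, PreservesPullback.iso_hom]
      exact ((congrArg (_ ≫ ·) h₂).trans
        ((isPullback_app Y.hom f (γ.obj d)).lift_snd y b h)).symm
  refine Eq.trans ?_ (congrArg (· ≫ g.left.app (γ.obj d)) (key y b h.symm))
  rw [Category.assoc]
  rfl

/-- Dependent products in functor categories, computed by induction on a degree, and their
compatibility with restriction along a functor inducing initial functors on lower slices. -/
theorem isPowerful_and_isIso_piComparison (f : B ⟶ A) (hdeg : DegreeCompatible deg f)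
    [∀ c : H, HasLimitsOfShape (Lower deg c) E]
    [∀ c : J, HasLimitsOfShape (Lower (deg ∘ γ.obj) c) E]
    (hinit : ∀ c : J, (Lower.along γ deg c).Initial) (hf : ∀ c, IsPowerful (f.app c)) :
    IsPowerful f ∧
    IsPowerful (((Functor.whiskeringLeft _ _ E).obj γ).map f) ∧
    ∀ (P : Over B ⥤ Over A) (adj : Over.pullback f ⊣ P)
      (P' : Over (γ ⋙ B) ⥤ Over (γ ⋙ A))
      (adj' : Over.pullback (((Functor.whiskeringLeft _ _ E).obj γ).map f) ⊣ P'),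
      IsIso (piComparison ((Functor.whiskeringLeft _ _ E).obj γ) f adj adj') := by
  have hrep : ∀ (X : Over B) c, RepresentableAt f X.hom c := fun X c =>
    representableAt_of_degreeCompatible hdeg hf c
  have hrep' : ∀ (X : Over (γ ⋙ B)) c, RepresentableAt (Functor.whiskerLeft γ f) X.hom c :=
    fun X c => representableAt_of_degreeCompatible (hdeg.along γ) (fun c => hf (γ.obj c)) c
  refine ⟨⟨inferInstance, isLeftAdjoint_of_exists_isPi f fun X => ?_⟩,
    ⟨inferInstance, isLeftAdjoint_of_exists_isPi _ fun X => ?_⟩, fun P adj P' adj' => ?_⟩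
  · obtain ⟨Y, g, hg, -⟩ := exists_isPi (hrep X)
    exact ⟨Y, g, hg⟩
  · obtain ⟨Y, g, hg, -⟩ := exists_isPi (hrep' X)
    exact ⟨Y, g, hg⟩
  · have : ∀ X, IsIso ((piComparison ((Functor.whiskeringLeft _ _ E).obj γ) f adj adj').app X) := by
      intro X
      -- The counit is pointwise universal, and so is its restriction along `γ`; hence the transpose
      -- under `adj'` is invertible.
      have h := (isPi_counit adj X).pointwiseUniversal (hrep X)
      have h' := h.along γ hdeg hinit
      rw [← Evaluation.ofHom_along] at h'
      exact h'.isPi.isIso_homEquiv adj'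
    exact NatIso.isIso_of_isIso_app _

end Along

/-! ### Functors which are bijective on outgoing maps -/

section Out

variable {C : Type u} [Category.{v} C] {C' : Type u₁} [Category.{v₁} C']
  {C'' : Type u₂} [Category.{v₂} C'']

/-- The maps out of an object. -/
abbrev Out (x : C) : Type (max u v) :=
  Σ y : C, (x ⟶ y)

/-- Transport of outgoing maps along an equality. -/
def Out.cast {x y : C} (h : x = y) (a : Out x) : Out y :=
  ⟨a.1, eqToHom h.symm ≫ a.2⟩

@[simp]
theorem Out.cast_rfl {x : C} (a : Out x) : Out.cast rfl a = a := by
  simp [Out.cast]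

theorem Out.cast_bijective {x y : C} (h : x = y) : Function.Bijective (Out.cast h) := by
  subst h
  rw [show Out.cast rfl = (id : Out x → Out x) from funext Out.cast_rfl]
  exact Function.bijective_id

/-- The action of a functor on outgoing maps. -/
def mapOut (F : C ⥤ C') (x : C) (a : Out x) : Out (F.obj x) :=
  ⟨F.obj a.1, F.map a.2⟩

/-- Precomposition of outgoing maps with a map. -/
def preOut {x y : C} (k : x ⟶ y) (a : Out y) : Out x :=
  ⟨a.1, k ≫ a.2⟩

theorem mapOut_preOut (F : C ⥤ C') {x y : C} (k : x ⟶ y) (a : Out y) :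
    mapOut F x (preOut k a) = preOut (F.map k) (mapOut F y a) := by
  simp [mapOut, preOut]

theorem cast_mapOut_comp {F : C ⥤ C'} {G : C' ⥤ C''} {K : C ⥤ C''} (hK : K = F ⋙ G) {x : C}
    {y : C'} (h : F.obj x = y) (h' : K.obj x = G.obj y) (a : Out x) :
    Out.cast h' (mapOut K x a) = mapOut G y (Out.cast h (mapOut F x a)) := by
  subst hK h
  exact (Out.cast_rfl (mapOut (F ⋙ G) x a)).trans
    (congrArg (mapOut G (F.obj x)) (Out.cast_rfl (mapOut F x a)).symm)

/-- A functor is a discrete opfibration if it is bijective on outgoing maps. -/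
def IsDiscreteOpfibration (F : C ⥤ C') : Prop :=
  ∀ x : C, Function.Bijective (mapOut F x)

theorem IsDiscreteOpfibration.id : IsDiscreteOpfibration (𝟭 C) :=
  fun _ => Function.bijective_id

theorem IsDiscreteOpfibration.comp {F : C ⥤ C'} {G : C' ⥤ C''} (hF : IsDiscreteOpfibration F)
    (hG : IsDiscreteOpfibration G) : IsDiscreteOpfibration (F ⋙ G) :=
  fun x => (hG (F.obj x)).comp (hF x)

theorem IsDiscreteOpfibration.of_fullyFaithful (F : C ⥤ C') [F.Full] [F.Faithful]
    (hF : Function.Injective F.obj)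
    (hF' : ∀ (x : C) (y : C') (_ : F.obj x ⟶ y), y ∈ Set.range F.obj) :
    IsDiscreteOpfibration F := by
  refine fun x => ⟨fun ⟨y, k⟩ ⟨y', k'⟩ h => ?_, fun ⟨y, k⟩ => ?_⟩
  · obtain rfl : y = y' := hF (congrArg Sigma.fst h)
    have : F.map k = F.map k' := eq_of_heq (Sigma.mk.inj h).2
    rw [F.map_injective this]
  · obtain ⟨z, rfl⟩ := hF' x y k
    exact ⟨⟨z, F.preimage k⟩, by simp [mapOut]⟩

end Out

/-! ### Colimits of free diagrams of discrete opfibrations -/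

section FreeDiagram

variable {N : Type u} [SmallCategory N] (I : Nᵒᵖ ⥤ Cat.{u, u}) (R : ∀ n, Set (I.obj (op n)))

/-- A decomposition of an object as the image of a root. -/
structure RootDecomposition {n : N} (i : I.obj (op n)) where
  stage : N
  hom : n ⟶ stage
  root : I.obj (op stage)
  mem : root ∈ R stage
  eq : (I.map hom.op).toFunctor.obj root = i

/-- A diagram of discrete opfibrations whose diagram of sets of objects is freely generated by the
roots. -/
structure IsFreeOn : Prop where
  exists_decomposition : ∀ {n : N} (i : I.obj (op n)), Nonempty (RootDecomposition I R i)
  unique_decomposition : ∀ {n : N} (i : I.obj (op n)), Subsingleton (RootDecomposition I R i)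
  isDiscreteOpfibration : ∀ {m n : N} (α : n ⟶ m), IsDiscreteOpfibration (I.map α.op).toFunctor

/-- The category of roots, whose maps are the functions between the sets of outgoing maps. -/
def RootCategory : Type u :=
  Σ n : N, R n

/-- A map `i ⟶ j` acts by precomposition from outgoing maps of `j` to those of `i`, which correspond
to those of their roots. As a target for the colimit, this category suffices to separate roots and
outgoing maps at a stage. -/
instance : SmallCategory (RootCategory I R) where
  Hom r s := Out s.2.1 → Out r.2.1
  id r := _root_.id
  comp f g := f ∘ g

variable {I R}

namespace RootDecomposition

variable {n : N} {i j k : I.obj (op n)}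

/-- The root of a decomposition. -/
def toRoot (d : RootDecomposition I R i) : RootCategory I R :=
  ⟨d.stage, d.root, d.mem⟩

/-- The image of a decomposition under a transition functor. -/
def push {n' : N} (α : n' ⟶ n) (d : RootDecomposition I R i) :
    RootDecomposition I R ((I.map α.op).toFunctor.obj i) where
  stage := d.stage
  hom := α ≫ d.hom
  root := d.root
  mem := d.mem
  eq := by
    rw [op_comp, I.map_comp, Cat.Hom.comp_toFunctor, Functor.comp_obj, d.eq]

/-- The map from the outgoing maps of the root. -/
def outMap (d : RootDecomposition I R i) (a : Out d.root) : Out i :=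
  Out.cast d.eq (mapOut (I.map d.hom.op).toFunctor d.root a)

theorem outMap_push {n' : N} (α : n' ⟶ n) (d : RootDecomposition I R i) (a : Out d.root) :
    (d.push α).outMap a = mapOut (I.map α.op).toFunctor i (d.outMap a) := by
  have h : (I.map (α ≫ d.hom).op).toFunctor =
      (I.map d.hom.op).toFunctor ⋙ (I.map α.op).toFunctor := by
    rw [op_comp, I.map_comp, Cat.Hom.comp_toFunctor]
  exact cast_mapOut_comp h d.eq _ a

theorem outMap_bijective (hI : IsFreeOn I R) (d : RootDecomposition I R i) : Function.Bijective d.outMap :=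
  (Out.cast_bijective d.eq).comp (hI.isDiscreteOpfibration d.hom d.root)

variable (hI : IsFreeOn I R)

/-- The function between outgoing maps of the roots induced by precomposition. -/
def transfer (d : RootDecomposition I R i) (d' : RootDecomposition I R j) (a : i ⟶ j)
    (b : Out d'.root) : Out d.root :=
  (Equiv.ofBijective _ (d.outMap_bijective hI)).symm (preOut a (d'.outMap b))

theorem outMap_transfer (d : RootDecomposition I R i) (d' : RootDecomposition I R j) (a : i ⟶ j)
    (b : Out d'.root) :
    d.outMap (d.transfer hI d' a b) = preOut a (d'.outMap b) :=
  (Equiv.ofBijective _ (d.outMap_bijective hI)).apply_symm_apply _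

/-- Transition functors change neither the roots nor the action on their outgoing maps. This makes
the root functors a cocone. -/
theorem transfer_push {n' : N} (α : n' ⟶ n) (d : RootDecomposition I R i)
    (d' : RootDecomposition I R j) (a : i ⟶ j) :
    (d.push α).transfer hI (d'.push α) ((I.map α.op).toFunctor.map a) = d.transfer hI d' a := by
  funext b
  apply ((d.push α).outMap_bijective hI).1
  refine ((d.push α).outMap_transfer hI (d'.push α) _ b).trans ?_
  refine Eq.trans ?_ (d.outMap_push α _).symm
  refine Eq.trans ?_
    (congrArg (mapOut (I.map α.op).toFunctor i) (d.outMap_transfer hI d' a b)).symm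
  rw [mapOut_preOut]
  exact congrArg _ (d'.outMap_push α b)

theorem transfer_id (d : RootDecomposition I R i) : d.transfer hI d (𝟙 i) = _root_.id := by
  funext b
  apply (d.outMap_bijective hI).1
  rw [outMap_transfer]
  simp [preOut]

theorem transfer_comp (d : RootDecomposition I R i) (d' : RootDecomposition I R j)
    (d'' : RootDecomposition I R k) (a : i ⟶ j) (b : j ⟶ k) :
    d.transfer hI d'' (a ≫ b) = d.transfer hI d' a ∘ d'.transfer hI d'' b := by
  funext c
  apply (d.outMap_bijective hI).1
  refine Eq.trans ?_ (d.outMap_transfer hI d' a (d'.transfer hI d'' b c)).symm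
  rw [outMap_transfer, outMap_transfer]
  simp [preOut]

end RootDecomposition

/-! ### Roots of the objects of the colimit -/

namespace IsFreeOn

variable (hI : IsFreeOn I R)

/-- The chosen root decomposition. -/
def dec {n : N} (i : I.obj (op n)) : RootDecomposition I R i :=
  (hI.exists_decomposition i).some

theorem dec_map {n n' : N} (α : n' ⟶ n) (i : I.obj (op n)) :
    hI.dec ((I.map α.op).toFunctor.obj i) = (hI.dec i).push α :=
  (hI.unique_decomposition _).elim _ _

/-- The functor sending an object to its root. -/
def rootFunctor (n : N) : I.obj (op n) ⥤ RootCategory I R where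
  obj i := (hI.dec i).toRoot
  map {i j} a := (hI.dec i).transfer hI (hI.dec j) a
  map_id _ := RootDecomposition.transfer_id hI _
  map_comp _ _ := RootDecomposition.transfer_comp hI _ _ _ _ _

theorem map_rootFunctor {n n' : N} (α : n' ⟶ n) :
    (I.map α.op).toFunctor ⋙ hI.rootFunctor n' = hI.rootFunctor n := by
  refine Functor.hext (fun i => ?_) fun i j a => ?_
  · exact congrArg RootDecomposition.toRoot (hI.dec_map α i)
  · have : ∀ {x y : I.obj (op n')} (d d₁ : RootDecomposition I R x)
        (d' d₁' : RootDecomposition I R y) (b : x ⟶ y), d = d₁ → d' = d₁' →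
        (show d.toRoot ⟶ d'.toRoot from d.transfer hI d' b) ≍
          (show d₁.toRoot ⟶ d₁'.toRoot from d₁.transfer hI d₁' b) := by
      rintro x y d _ d' _ b rfl rfl
      rfl
    exact (this _ _ _ _ _ (hI.dec_map α i) (hI.dec_map α j)).trans
      (heq_of_eq (RootDecomposition.transfer_push hI α _ _ a))

/-- The functors to the category of roots form a cocone. -/
def rootCocone : Cocone I where
  pt := Cat.of (RootCategory I R)
  ι :=
    { app := fun n => (hI.rootFunctor n.unop).toCatHom
      naturality := fun _ _ α => Cat.Hom.ext (hI.map_rootFunctor α.unop) }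

/-- The functor from the colimit to the category of roots. -/
def colimitRoot : colimit I ⟶ Cat.of (RootCategory I R) :=
  colimit.desc I hI.rootCocone

theorem ι_colimitRoot (n : N) :
    (colimit.ι I (op n)).toFunctor ⋙ hI.colimitRoot.toFunctor = hI.rootFunctor n :=
  congrArg Cat.Hom.toFunctor (colimit.ι_desc hI.rootCocone (op n))

/-- The root factors through the colimit, being the object part of a cocone. -/
theorem dec_toRoot_eq {n n' : N} {i : I.obj (op n)} {i' : I.obj (op n')}
    (h : (colimit.ι I (op n)).toFunctor.obj i = (colimit.ι I (op n')).toFunctor.obj i') :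
    (hI.dec i).toRoot = (hI.dec i').toRoot := by
  have e := congrArg hI.colimitRoot.toFunctor.obj h
  have h₁ := Functor.congr_obj (hI.ι_colimitRoot n) i
  have h₂ := Functor.congr_obj (hI.ι_colimitRoot n') i'
  exact h₁.symm.trans (e.trans h₂)

theorem ι_injective_of_root (hI : IsFreeOn I R) {n n' : N} {i : I.obj (op n)} {i' : I.obj (op n')} (hi : i ∈ R n)
    (hi' : i' ∈ R n')
    (h : (colimit.ι I (op n)).toFunctor.obj i = (colimit.ι I (op n')).toFunctor.obj i') :
    (⟨n, i, hi⟩ : RootCategory I R) = ⟨n', i', hi'⟩ := by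
  have key : ∀ {n : N} (i : I.obj (op n)) (hi : i ∈ R n),
      (hI.dec i).toRoot = ⟨n, i, hi⟩ := fun {n} i hi => by
    have : hI.dec i = ⟨n, 𝟙 n, i, hi, by simp⟩ := (hI.unique_decomposition _).elim _ _
    rw [this]
    rfl
  rw [← key i hi, ← key i' hi']
  exact hI.dec_toRoot_eq h

/-- The root functor factors through the leg, and it already separates outgoing maps. -/
theorem ι_mapOut_injective (hI : IsFreeOn I R) (n : N) (i : I.obj (op n)) :
    Function.Injective (mapOut (colimit.ι I (op n)).toFunctor i) := by
  intro a b h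
  have h' : mapOut (hI.rootFunctor n) i a = mapOut (hI.rootFunctor n) i b := by
    rw [← hI.ι_colimitRoot n]
    exact congrArg (mapOut hI.colimitRoot.toFunctor _) h
  -- As for representable functors, a map is recovered from its precomposition action by evaluating
  -- at an identity, here that of the root of the target.
  let ev : Out (hI.dec i).toRoot → Out (hI.dec i).root := fun c => c.2 ⟨_, 𝟙 _⟩
  have hev : ∀ a : Out i, (hI.dec i).outMap (ev (mapOut (hI.rootFunctor n) i a)) = a := fun a => by
    refine (RootDecomposition.outMap_transfer hI _ _ _ _).trans ?_
    obtain ⟨j, a⟩ := a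
    have : ∀ d : RootDecomposition I R j, preOut a (d.outMap ⟨_, 𝟙 _⟩) = ⟨j, a⟩ := by
      rintro ⟨m, α, j₀, hj, rfl⟩
      rw [RootDecomposition.outMap, Out.cast_rfl]
      simp [mapOut, preOut]
    exact this _
  rw [← hev a, ← hev b, h']

/-! ### Lifting maps of the colimit along its legs -/

/-- A map of the colimit is liftable if it lifts along all legs. -/
def liftable : MorphismProperty (colimit I : Cat.{u, u}) := fun x y k =>
  ∀ (n : N) (i : I.obj (op n)) (h : (colimit.ι I (op n)).toFunctor.obj i = x),
    ∃ b : Out i, Out.cast h (mapOut (colimit.ι I (op n)).toFunctor i b) = ⟨y, k⟩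

theorem liftable_id (x : (colimit I : Cat.{u, u})) : liftable (𝟙 x) := by
  rintro n i rfl
  exact ⟨⟨i, 𝟙 i⟩, by simp [mapOut]⟩

theorem liftable_comp {x y z : (colimit I : Cat.{u, u})} (k : x ⟶ y) (l : y ⟶ z)
    (hk : liftable k) (hl : liftable l) : liftable (k ≫ l) := by
  rintro n i rfl
  obtain ⟨⟨j, b⟩, hb⟩ := hk n i rfl
  rw [Out.cast_rfl] at hb
  obtain ⟨rfl, hb⟩ := Sigma.mk.inj hb
  obtain rfl := eq_of_heq hb
  obtain ⟨⟨j', b'⟩, hb'⟩ := hl n j rfl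
  rw [Out.cast_rfl] at hb'
  obtain ⟨rfl, hb'⟩ := Sigma.mk.inj hb'
  obtain rfl := eq_of_heq hb'
  exact ⟨⟨j', b ≫ b'⟩, by simp [mapOut]⟩

instance : (liftable (I := I)).IsMultiplicative where
  id_mem := liftable_id
  comp_mem k l := liftable_comp k l

theorem ι_eq (n m : N) (α : n ⟶ m) :
    (colimit.ι I (op m)).toFunctor = (I.map α.op).toFunctor ⋙ (colimit.ι I (op n)).toFunctor :=
  congrArg Cat.Hom.toFunctor (colimit.w I α.op).symm

/-- Objects `i` and `i'` with the same image in the colimit have the same root. Both have the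
outgoing maps of that root, so the map `a` out of `i` goes back to the root and then forward to
`i'`. -/
theorem liftable_ι (hI : IsFreeOn I R) {n : N} {i j : I.obj (op n)} (a : i ⟶ j) :
    liftable ((colimit.ι I (op n)).toFunctor.map a) := by
  intro n' i' h
  have hr := hI.dec_toRoot_eq h
  generalize hI.dec i = d at hr
  generalize hI.dec i' = d' at hr
  obtain ⟨m, α, r, hr₁, hr₂⟩ := d
  obtain ⟨m', α', r', hr₁', hr₂'⟩ := d'
  obtain ⟨rfl, e⟩ := Sigma.mk.inj hr
  obtain rfl : r' = r := congrArg Subtype.val (eq_of_heq e)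
  obtain ⟨b, hb⟩ := (RootDecomposition.outMap_bijective hI ⟨m', α, r', hr₁, hr₂⟩).2 ⟨j, a⟩
  refine ⟨RootDecomposition.outMap ⟨m', α', r', hr₁', hr₂'⟩ b, ?_⟩
  have e₁ := cast_mapOut_comp (ι_eq n m' α) hr₂ (by rw [ι_eq n m' α, ← hr₂]; rfl) b
  have e₂ := cast_mapOut_comp (ι_eq n' m' α') hr₂' (by rw [ι_eq n' m' α', ← hr₂']; rfl) b
  have e₃ := congrArg (mapOut (colimit.ι I (op n)).toFunctor i) hb
  refine Eq.trans ?_ ((e₁.trans e₃))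
  refine (congrArg (Out.cast h) e₂.symm).trans ?_
  simp [Out.cast]

/-- The legs of the colimit form a cocone of the subcategory of liftable maps. -/
def liftableCocone : Cocone I where
  pt := Cat.of (WideSubcategory (liftable (I := I)))
  ι :=
    { app := fun n => Functor.toCatHom
        { obj := fun i => ⟨(colimit.ι I n).toFunctor.obj i⟩
          map := fun a => ⟨(colimit.ι I n).toFunctor.map a, hI.liftable_ι a⟩
          map_id := fun i =>
            WideSubcategory.hom_ext _ ((colimit.ι I n).toFunctor.map_id i)
          map_comp := fun a b =>
            WideSubcategory.hom_ext _ ((colimit.ι I n).toFunctor.map_comp a b) }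
      naturality := fun n n' α => by
        have h := ι_eq (I := I) n'.unop n.unop α.unop
        refine Cat.Hom.ext (Functor.hext (fun i => ?_) fun i j a => ?_)
        · exact congrArg WideSubcategory.mk (Functor.congr_obj h i).symm
        · have key : ∀ {x x' y y' : (colimit I : Cat.{u, u})} (k : x ⟶ y) (k' : x' ⟶ y')
              (hk : liftable k) (hk' : liftable k'), x = x' → y = y' → k ≍ k' →
              (⟨k, hk⟩ : (⟨x⟩ : WideSubcategory (liftable (I := I))) ⟶ ⟨y⟩) ≍
                (⟨k', hk'⟩ : (⟨x'⟩ : WideSubcategory (liftable (I := I))) ⟶ ⟨y'⟩) := by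
            rintro x _ y _ k _ hk hk' rfl rfl h
            obtain rfl := eq_of_heq h
            rfl
          exact key _ _ _ _ (Functor.congr_obj h i).symm (Functor.congr_obj h j).symm
            (Functor.hcongr_hom h a).symm }

/-- The cocone of legs factors through the wide subcategory of liftable maps. By the universal
property the induced functor followed by the inclusion is the identity of the colimit, so every map
is liftable. -/
theorem liftable_all (hI : IsFreeOn I R) {x y : (colimit I : Cat.{u, u})} (k : x ⟶ y) : liftable k := by
  let F : colimit I ⟶ Cat.of (WideSubcategory (liftable (I := I))) :=
    colimit.desc I hI.liftableCocone
  let G : Cat.of (WideSubcategory (liftable (I := I))) ⟶ colimit I :=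
    (wideSubcategoryInclusion _).toCatHom
  have hFG : F ≫ G = 𝟙 _ := by
    refine colimit.hom_ext fun n => ?_
    exact (Category.assoc _ _ _).symm.trans
      (congrArg (· ≫ G) (colimit.ι_desc hI.liftableCocone n))
  have key : ∀ K : (colimit I : Cat.{u, u}) ⥤ (colimit I : Cat.{u, u}), K = 𝟭 _ →
      liftable (K.map k) → liftable k := by
    rintro _ rfl h
    exact h
  exact key (F ≫ G).toFunctor (congrArg Cat.Hom.toFunctor hFG) (F.toFunctor.map k).property

variable (I) in
/-- The objects in the image of a leg of the colimit. -/
def legImage : ObjectProperty (colimit I : Cat.{u, u}) := fun x =>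
  ∃ (n : N) (i : I.obj (op n)), (colimit.ι I (op n)).toFunctor.obj i = x

variable (I) in
/-- The legs of the colimit form a cocone of the full subcategory on their images. -/
def legImageCocone : Cocone I where
  pt := Cat.of (legImage I).FullSubcategory
  ι :=
    { app := fun n =>
        ((legImage I).lift (colimit.ι I n).toFunctor fun i => ⟨n.unop, i, rfl⟩).toCatHom
      naturality := fun n n' α => by
        have key : ∀ {C : Type u} [SmallCategory C] (K K' : C ⥤ (colimit I : Cat.{u, u}))
            (hK : ∀ x, legImage I (K.obj x)) (hK' : ∀ x, legImage I (K'.obj x)), K = K' →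
            (legImage I).lift K hK = (legImage I).lift K' hK' := by
          rintro C _ K _ hK hK' rfl
          rfl
        refine Cat.Hom.ext ?_
        exact key ((I.map α).toFunctor ⋙ (colimit.ι I n').toFunctor) (colimit.ι I n).toFunctor
          (fun i => ⟨n'.unop, _, rfl⟩) (fun i => ⟨n.unop, i, rfl⟩)
          (ι_eq (I := I) n'.unop n.unop α.unop).symm }

/-- The same argument as for `liftable_all`, with the full subcategory on the images of the legs. -/
theorem exists_ι_eq (x : (colimit I : Cat.{u, u})) : legImage I x := by
  let F : colimit I ⟶ Cat.of (legImage I).FullSubcategory := colimit.desc I (legImageCocone I)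
  let G : Cat.of (legImage I).FullSubcategory ⟶ colimit I := (legImage I).ι.toCatHom
  have hFG : F ≫ G = 𝟙 _ := by
    refine colimit.hom_ext fun n => ?_
    exact (Category.assoc _ _ _).symm.trans
      (congrArg (· ≫ G) (colimit.ι_desc (legImageCocone I) n))
  have e := Functor.congr_obj (congrArg Cat.Hom.toFunctor hFG) x
  obtain ⟨n, i, h⟩ := (F.toFunctor.obj x).property
  exact ⟨n, i, h.trans e⟩

theorem exists_root (hI : IsFreeOn I R) (x : (colimit I : Cat.{u, u})) :
    ∃ (n : N) (i : I.obj (op n)), i ∈ R n ∧ (colimit.ι I (op n)).toFunctor.obj i = x := by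
  obtain ⟨n, i, rfl⟩ := exists_ι_eq x
  obtain ⟨m, α, r, hr, rfl⟩ := hI.dec i
  exact ⟨m, r, hr, Functor.congr_obj (ι_eq n m α) r⟩

theorem isDiscreteOpfibration_ι (hI : IsFreeOn I R) (n : N) :
    IsDiscreteOpfibration (colimit.ι I (op n)).toFunctor := by
  refine fun i => ⟨hI.ι_mapOut_injective n i, fun ⟨y, k⟩ => ?_⟩
  obtain ⟨b, hb⟩ := hI.liftable_all k n i rfl
  exact ⟨b, by rwa [Out.cast_rfl] at hb⟩

end IsFreeOn

end FreeDiagram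

/-! ### Under categories of discrete opfibrations and of collages -/

section UnderCategory

variable {C : Type u₁} [Category.{v₁} C] {C' : Type u₂} [Category.{v₂} C']

theorem exists_eq_eqToHom_of_eq_mk_id {c : C} {X : Under c} (h : X = Under.mk (𝟙 c)) :
    ∃ h : c = X.right, X.hom = eqToHom h := by
  subst h
  exact ⟨rfl, rfl⟩

theorem mk_eq_mk_id_of_eq_eqToHom {c d : C} {k : c ⟶ d} (h : c = d) (hk : k = eqToHom h) :
    Under.mk k = Under.mk (𝟙 c) := by
  subst h hk
  rfl

theorem IsDiscreteOpfibration.exists_map_eq {F : C ⥤ C'} (hF : IsDiscreteOpfibration F) {x : C}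
    (X : Under (F.obj x)) : ∃ Y : Under x, Under.mk (F.map Y.hom) = X := by
  obtain ⟨⟨y, k⟩, h⟩ := (hF x).2 ⟨X.right, X.hom⟩
  refine ⟨Under.mk k, ?_⟩
  have key : ∀ {a : C'} (b b' : Out a), b = b' → Under.mk b.2 = Under.mk b'.2 := by
    rintro a b _ rfl
    rfl
  exact key _ _ h

theorem IsDiscreteOpfibration.faithful {F : C ⥤ C'} (hF : IsDiscreteOpfibration F) :
    F.Faithful where
  map_injective {x y} k k' h := by
    have := (hF x).1 (a₁ := ⟨y, k⟩) (a₂ := ⟨y, k'⟩) (Sigma.ext rfl (heq_of_eq h))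
    exact eq_of_heq (Sigma.mk.inj this).2

/-- The underlying map of `l` lifts to a map out of `Y.right`. Its composite with `Y.hom` has the
same image as `Y'.hom`, so the two agree, targets included, by uniqueness of lifts from `x`. -/
theorem IsDiscreteOpfibration.full_post {F : C ⥤ C'} (hF : IsDiscreteOpfibration F) (x : C) :
    (Under.post (X := x) F).Full where
  map_surjective {Y Y'} l := by
    obtain ⟨⟨z, k⟩, h⟩ := (hF Y.right).2 ⟨F.obj Y'.right, l.right⟩
    have hl : F.map Y.hom ≫ l.right = F.map Y'.hom := Under.w l
    have e : (⟨z, Y.hom ≫ k⟩ : Out x) = ⟨Y'.right, Y'.hom⟩ := by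
      apply (hF x).1
      refine (mapOut_preOut F Y.hom ⟨z, k⟩).trans ?_
      rw [h]
      exact Sigma.ext rfl (heq_of_eq hl)
    obtain ⟨rfl, e⟩ := Sigma.mk.inj e
    refine ⟨Under.homMk k (eq_of_heq e), ?_⟩
    ext
    exact eq_of_heq (Sigma.mk.inj h).2

theorem IsDiscreteOpfibration.faithful_post {F : C ⥤ C'} (hF : IsDiscreteOpfibration F) (x : C) :
    (Under.post (X := x) F).Faithful where
  map_injective {Y Y'} l l' h := by
    have := hF.faithful
    ext
    exact F.map_injective (congrArg CommaMorphism.right h)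

end UnderCategory

namespace Collage

variable {C : Type u} [Category.{v} C] {D : Type u} [Category.{v} D] (H : Cᵒᵖ ⥤ D ⥤ Type v)

instance : (inrFunctor H).Full where
  map_surjective k := ⟨k, rfl⟩

instance : (inrFunctor H).Faithful where
  map_injective h := h

theorem isDiscreteOpfibration_inrFunctor : IsDiscreteOpfibration (inrFunctor H) :=
  IsDiscreteOpfibration.of_fullyFaithful _ (fun _ _ h => inr.inj h) fun x y k => by
    rcases y with c | d
    · exact PEmpty.elim k
    · exact ⟨d, rfl⟩

instance (c : C) : (elementsToUnder H c).Full where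
  map_surjective {x y} l := ⟨⟨l.right, Under.w l⟩, by ext; rfl⟩

instance (c : C) : (elementsToUnder H c).Faithful where
  map_injective h := CategoryOfElements.ext _ _ _ (congrArg CommaMorphism.right h)

end Collage

/-! ### Strict inverse structures -/

namespace StrictInverseStructure

variable {N : Type u} [Category.{v} N] (S : StrictInverseStructure N)

theorem deg_le {m n : N} (k : m ⟶ n) : S.deg n ≤ S.deg m := by
  by_cases h : IsIso k
  · exact (S.deg_eq k h).ge
  · exact (S.deg_lt k h).le

/-- Strictness enters here: an isomorphism out of `n` is an identity, and that object of the slice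
is excluded. -/
theorem deg_right_lt {n : N} (a : Boundary n) : S.deg a.obj.right < S.deg n := by
  refine S.deg_lt a.obj.hom fun h => a.property ?_
  obtain ⟨h, e⟩ := S.eq_id _ h
  exact mk_eq_mk_id_of_eq_eqToHom h e

theorem ne_mk_id_of_deg_lt {n m : N} (k : n ⟶ m) (h : S.deg m < S.deg n) :
    Under.mk k ≠ Under.mk (𝟙 n) := fun e =>
  h.ne (congrArg (fun X : Under n => S.deg X.right) e)

/-- The object of the boundary obtained by composition. -/
def compBoundary {n : N} (a : Boundary n) {m : N} (k : a.obj.right ⟶ m) : Boundary n :=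
  ⟨Under.mk (a.obj.hom ≫ k),
    S.ne_mk_id_of_deg_lt _ ((S.deg_le k).trans_lt (S.deg_right_lt a))⟩

end StrictInverseStructure

/-! ### The stages of an iterated gluing diagram -/

namespace IteratedGluingDiagram

variable (D : IteratedGluingDiagram.{u})

/-- The objects of a stage which come from its boundary. -/
def roots (n : D.N) : Set (D.I.obj (op n)) :=
  {i | ∃ x : D.bd n, (D.glue n).inv.toFunctor.obj (Collage.inl x) = i}

/-- The condition on a stage for `D.I` to be free on the boundaries. -/
structure IsFreeAt (n : D.N) : Prop where
  exists_decomposition : ∀ i : D.I.obj (op n), Nonempty (RootDecomposition D.I D.roots i)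
  unique_decomposition : ∀ i : D.I.obj (op n), Subsingleton (RootDecomposition D.I D.roots i)
  isDiscreteOpfibration : ∀ {m : D.N} (α : n ⟶ m), IsDiscreteOpfibration (D.I.map α.op).toFunctor

/-- The diagram whose colimit is the interior. -/
abbrev interiorDiagram (n : D.N) : (Boundary n)ᵒᵖ ⥤ Cat.{u, u} :=
  (Boundary.proj n).op ⋙ D.I

/-- The roots of the diagram whose colimit is the interior. -/
def interiorRoots (n : D.N) (a : Boundary n) : Set ((D.interiorDiagram n).obj (op a)) :=
  D.roots a.obj.right

variable {D}

/-- Root decompositions in `D.I` give root decompositions in the diagram of the interior. -/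
def liftDecomposition {n : D.N} {a : Boundary n} {i : D.I.obj (op a.obj.right)}
    (d : RootDecomposition D.I D.roots i) :
    RootDecomposition (D.interiorDiagram n) (D.interiorRoots n) (n := a) i where
  stage := D.inverse.compBoundary a d.hom
  hom := ObjectProperty.homMk (Under.homMk d.hom rfl)
  root := d.root
  mem := d.mem
  eq := d.eq

/-- The intermediate object of the slice carries no extra data, since its structure map is forced to
be the composite. -/
theorem exists_eq_liftDecomposition {n : D.N} {a : Boundary n} {i : D.I.obj (op a.obj.right)}
    (d : RootDecomposition (D.interiorDiagram n) (D.interiorRoots n) (n := a) i) :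
    ∃ d' : RootDecomposition D.I D.roots i, d = liftDecomposition d' := by
  refine ⟨⟨d.stage.obj.right, d.hom.hom.right, d.root, d.mem, d.eq⟩, ?_⟩
  obtain ⟨⟨⟨⟨⟨⟩⟩, b, k⟩, hb⟩, l, r, hr, e⟩ := d
  obtain ⟨β, hβ⟩ : ∃ β : a.obj.right ⟶ b, β = l.hom.right := ⟨_, rfl⟩
  obtain rfl : a.obj.hom ≫ β = k := hβ ▸ Under.w l.hom
  obtain rfl : l = ObjectProperty.homMk (Under.homMk β rfl) := by
    ext
    exact hβ.symm
  rfl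

theorem isFreeOn_interiorDiagram {n : D.N}
    (h : ∀ m, D.inverse.deg m < D.inverse.deg n → D.IsFreeAt m) :
    IsFreeOn (D.interiorDiagram n) (D.interiorRoots n) where
  exists_decomposition {a} i :=
    ((h _ (D.inverse.deg_right_lt a)).exists_decomposition i).map liftDecomposition
  unique_decomposition {a} i := ⟨fun d d' => by
    obtain ⟨d, rfl⟩ := exists_eq_liftDecomposition d
    obtain ⟨d', rfl⟩ := exists_eq_liftDecomposition d'
    exact congrArg _ (((h _ (D.inverse.deg_right_lt a)).unique_decomposition i).elim d d')⟩
  isDiscreteOpfibration {b a} l :=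
    (h _ (D.inverse.deg_right_lt a)).isDiscreteOpfibration l.hom.right

variable (D)

theorem glue_inv_hom_obj (n : D.N) (x : Collage (D.attach n)) :
    (D.glue n).hom.toFunctor.obj ((D.glue n).inv.toFunctor.obj x) = x :=
  Functor.congr_obj (congrArg Cat.Hom.toFunctor (D.glue n).inv_hom_id) x

theorem glue_hom_inv_obj (n : D.N) (i : D.I.obj (op n)) :
    (D.glue n).inv.toFunctor.obj ((D.glue n).hom.toFunctor.obj i) = i :=
  Functor.congr_obj (congrArg Cat.Hom.toFunctor (D.glue n).hom_inv_id) i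

theorem isDiscreteOpfibration_glue_inv (n : D.N) :
    IsDiscreteOpfibration (D.glue n).inv.toFunctor := by
  have : (D.glue n).inv.toFunctor.IsEquivalence :=
    (Cat.equivOfIso (D.glue n)).symm.isEquivalence_functor
  exact IsDiscreteOpfibration.of_fullyFaithful _
    (Function.LeftInverse.injective (D.glue_inv_hom_obj n)) fun _ y _ =>
    ⟨_, D.glue_hom_inv_obj n y⟩

theorem map_eq (n : D.N) (a : Boundary n) :
    (D.I.map a.obj.hom.op).toFunctor =
      (interiorLeg D.I n a).toFunctor ⋙ Collage.inrFunctor (D.attach n) ⋙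
        (D.glue n).inv.toFunctor :=
  congrArg Cat.Hom.toFunctor
    (((Iso.eq_comp_inv _).2 (D.glue_comp n a)).trans (Category.assoc _ _ _))

theorem glue_hom_map_obj (n : D.N) (a : Boundary n) (r : D.I.obj (op a.obj.right)) :
    (D.glue n).hom.toFunctor.obj ((D.I.map a.obj.hom.op).toFunctor.obj r) =
      Collage.inr ((interiorLeg D.I n a).toFunctor.obj r) :=
  Functor.congr_obj (congrArg Cat.Hom.toFunctor (D.glue_comp n a)) r

variable {D}

theorem exists_eq_of_decomposition {n : D.N} {i : D.I.obj (op n)}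
    (d : RootDecomposition D.I D.roots i) :
    (∃ h : i ∈ D.roots n, d = ⟨n, 𝟙 n, i, h, by simp⟩) ∨
    ∃ (a : Boundary n) (r : D.I.obj (op a.obj.right)) (h : r ∈ D.roots a.obj.right)
      (e : (D.I.map a.obj.hom.op).toFunctor.obj r = i), d = ⟨a.obj.right, a.obj.hom, r, h, e⟩ := by
  obtain ⟨m, α, r, hr, e⟩ := d
  by_cases h : Under.mk α = Under.mk (𝟙 n)
  · obtain ⟨rfl, e'⟩ : ∃ h : n = m, α = eqToHom h := exists_eq_eqToHom_of_eq_mk_id h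
    obtain rfl : α = 𝟙 _ := e'
    obtain rfl : r = i := by simpa using e
    exact Or.inl ⟨hr, rfl⟩
  · exact Or.inr ⟨⟨Under.mk α, h⟩, r, hr, e, rfl⟩

/-- An object of the collage is either in the boundary, where it is its own root, or in the
interior, where freeness supplies the root. A non-identity transition is a leg, then the inclusion
of the interior, then an isomorphism, all discrete opfibrations. -/
theorem isFreeAt_of_interior {n : D.N}
    (h : IsFreeOn (D.interiorDiagram n) (D.interiorRoots n)) : D.IsFreeAt n where
  exists_decomposition i := by
    have hi := D.glue_hom_inv_obj n i
    generalize (D.glue n).hom.toFunctor.obj i = c at hi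
    subst hi
    rcases c with x | y
    · exact ⟨⟨n, 𝟙 n, _, ⟨x, rfl⟩, by simp⟩⟩
    · obtain ⟨a, r, hr, rfl⟩ := h.exists_root y
      exact ⟨⟨a.obj.right, a.obj.hom, r, hr, Functor.congr_obj (D.map_eq n a) r⟩⟩
  unique_decomposition i := ⟨fun d d' => by
    -- Boundary and interior are disjoint in the collage.
    have key : ∀ (_ : i ∈ D.roots n) (a : Boundary n) (r : D.I.obj (op a.obj.right))
        (_ : (D.I.map a.obj.hom.op).toFunctor.obj r = i), False := by
      rintro ⟨x, hx⟩ a r rfl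
      have e := congrArg (D.glue n).hom.toFunctor.obj hx
      rw [D.glue_inv_hom_obj, D.glue_hom_map_obj] at e
      cases e
    rcases exists_eq_of_decomposition d with ⟨_, rfl⟩ | ⟨a, r, hr, e, rfl⟩ <;>
      rcases exists_eq_of_decomposition d' with ⟨_, rfl⟩ | ⟨a', r', hr', e', rfl⟩
    · rfl
    · exact (key ‹_› a' r' e').elim
    · exact (key ‹_› a r e).elim
    -- The two roots agree already in the interior, where roots are separated together with the map
    -- out of `n` that carries them.
    · have e₁ := congrArg (D.glue n).hom.toFunctor.obj (e.trans e'.symm)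
      rw [D.glue_hom_map_obj, D.glue_hom_map_obj] at e₁
      have e₂ := h.ι_injective_of_root (n := a) (n' := a') hr hr' (Collage.inr.inj e₁)
      obtain ⟨rfl, e₃⟩ := Sigma.mk.inj e₂
      obtain rfl : r = r' := congrArg Subtype.val (eq_of_heq e₃)
      rfl⟩
  isDiscreteOpfibration {m} α := by
    by_cases hα : Under.mk α = Under.mk (𝟙 n)
    · obtain ⟨rfl, e'⟩ : ∃ h : n = m, α = eqToHom h := exists_eq_eqToHom_of_eq_mk_id hα
      obtain rfl : α = 𝟙 _ := e'
      have e : (D.I.map (𝟙 n).op).toFunctor = 𝟭 _ := by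
        rw [op_id, D.I.map_id, Cat.Hom.id_toFunctor]
      exact e ▸ IsDiscreteOpfibration.id
    · refine (congrArg (fun F => IsDiscreteOpfibration F) (D.map_eq n ⟨Under.mk α, hα⟩)).mpr ?_
      exact (h.isDiscreteOpfibration_ι _).comp
        ((Collage.isDiscreteOpfibration_inrFunctor _).comp (D.isDiscreteOpfibration_glue_inv n))

variable (D)

theorem isFreeAt (n : D.N) : D.IsFreeAt n := by
  induction h : D.inverse.deg n using Nat.strong_induction_on generalizing n with
  | _ k ih =>
    subst h
    exact isFreeAt_of_interior (isFreeOn_interiorDiagram fun m hm => ih _ hm m rfl)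

theorem isFreeOn_interior (n : D.N) :
    IsFreeOn (D.interiorDiagram n) (D.interiorRoots n) :=
  isFreeOn_interiorDiagram fun m _ => D.isFreeAt m

theorem isFreeOn : IsFreeOn D.I D.roots where
  exists_decomposition := (D.isFreeAt _).exists_decomposition
  unique_decomposition := (D.isFreeAt _).unique_decomposition
  isDiscreteOpfibration := (D.isFreeAt _).isDiscreteOpfibration

/-! ### The degree on the iterated gluing category -/

theorem isDiscreteOpfibration_fromCollage (n : D.N) :
    IsDiscreteOpfibration (D.fromCollage n) :=
  (D.isDiscreteOpfibration_glue_inv n).comp (D.isFreeOn.isDiscreteOpfibration_ι n)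

theorem exists_fromBd_eq (c : D.total) : ∃ (n : D.N) (i : D.bd n), (D.fromBd n).obj i = c := by
  obtain ⟨n, _, ⟨x, rfl⟩, rfl⟩ := D.isFreeOn.exists_root c
  exact ⟨n, x, rfl⟩

theorem eq_of_fromBd_eq {n m : D.N} {i : D.bd n} {j : D.bd m}
    (h : (D.fromBd n).obj i = (D.fromBd m).obj j) : n = m :=
  congrArg Sigma.fst (D.isFreeOn.ι_injective_of_root ⟨i, rfl⟩ ⟨j, rfl⟩ h)

/-- The degree of the stage at which an object of the iterated gluing category is added. -/
def degree (c : D.total) : ℕ :=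
  D.inverse.deg (D.exists_fromBd_eq c).choose

theorem degree_fromBd {n : D.N} (i : D.bd n) :
    D.degree ((D.fromBd n).obj i) = D.inverse.deg n :=
  congrArg D.inverse.deg
    (D.eq_of_fromBd_eq (D.exists_fromBd_eq ((D.fromBd n).obj i)).choose_spec.choose_spec)

/-- An object of the interior has a root at some stage strictly below `n`, and that stage determines
its degree. -/
theorem degree_fromInterior_lt {n : D.N} (y : interior D.I n) :
    D.degree ((D.fromInterior n).obj y) < D.inverse.deg n := by
  obtain ⟨a, _, ⟨x, rfl⟩, rfl⟩ := (D.isFreeOn_interior n).exists_root y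
  have e : (D.fromInterior n).obj ((interiorLeg D.I n a).toFunctor.obj
      ((D.glue a.obj.right).inv.toFunctor.obj (Collage.inl x))) =
      (D.fromBd a.obj.right).obj x := by
    have e₁ := Functor.congr_obj (D.map_eq n a)
      ((D.glue a.obj.right).inv.toFunctor.obj (Collage.inl x))
    have e₂ := Functor.congr_obj (IsFreeOn.ι_eq (I := D.I) n a.obj.right a.obj.hom)
      ((D.glue a.obj.right).inv.toFunctor.obj (Collage.inl x))
    exact (congrArg (colimit.ι D.I (op n)).toFunctor.obj e₁).symm.trans e₂.symm
  exact (congrArg D.degree e).trans_lt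
    ((D.degree_fromBd x).trans_lt (D.inverse.deg_right_lt a))

variable {D} in
theorem degree_lowerSlice_lt {n : D.N} {i : D.bd n} (x : D.LowerSlice i) :
    D.degree ((D.fromInterior n).obj x.1) < D.degree ((D.fromBd n).obj i) :=
  (D.degree_fromInterior_lt x.1).trans_eq (D.degree_fromBd i).symm

/-- The functor from `i/I_{<n}` to the lower slice of the iterated gluing category. -/
def lowerSliceFunctor {n : D.N} (i : D.bd n) :
    D.LowerSlice i ⥤ Lower D.degree ((D.fromBd n).obj i) :=
  ObjectProperty.lift _
    (Collage.elementsToUnder (D.attach n) i ⋙ Under.post (D.fromCollage n))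
    degree_lowerSlice_lt

/-- Maps out of `[i]` lift uniquely to the collage at `n`. Those ending in the boundary preserve the
degree, so the lower slice consists of those ending in the interior, which are the elements of the
attaching profunctor. -/
instance {n : D.N} (i : D.bd n) : (D.lowerSliceFunctor i).IsEquivalence := by
  have := (D.isDiscreteOpfibration_fromCollage n).full_post
    ((Collage.inlFunctor (D.attach n)).obj i)
  have := (D.isDiscreteOpfibration_fromCollage n).faithful_post
    ((Collage.inlFunctor (D.attach n)).obj i)
  have h₁ : (Collage.elementsToUnder (D.attach n) i ⋙
      Under.post (D.fromCollage n)).Full := Functor.Full.comp _ _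
  have h₂ : (Collage.elementsToUnder (D.attach n) i ⋙
      Under.post (D.fromCollage n)).Faithful := Functor.Faithful.comp _ _
  have h₃ : (D.lowerSliceFunctor i).Full :=
    ⟨fun l => ⟨h₁.map_surjective l.hom |>.choose,
      ObjectProperty.hom_ext _ (h₁.map_surjective l.hom).choose_spec⟩⟩
  have h₄ : (D.lowerSliceFunctor i).Faithful :=
    ⟨fun h => h₂.map_injective (congrArg (fun l => l.hom) h)⟩
  have h₅ : (D.lowerSliceFunctor i).EssSurj := ⟨by
    rintro ⟨X, hX⟩
    obtain ⟨⟨⟨⟨⟩⟩, z, k⟩, rfl⟩ := (D.isDiscreteOpfibration_fromCollage n).exists_map_eq X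
    rcases z with j | y
    · exact absurd hX (((D.degree_fromBd j).trans (D.degree_fromBd i).symm).not_lt)
    · exact ⟨⟨y, k⟩, ⟨Iso.refl _⟩⟩⟩
  exact {}

end IteratedGluingDiagram

/-! ### The homotopy category of an iterated gluing category -/

namespace IteratedGluingDiagram

variable (D : IteratedGluingDiagram.{u}) (W : MorphismProperty D.total)

/-- The degree on the homotopy category. -/
def hoDegree (c : W.Localization) : ℕ :=
  D.degree ((Localization.Construction.objEquiv W).symm c)

theorem exists_hoObj_eq (c : W.Localization) : ∃ (n : D.N) (i : D.bd n), D.hoObj W i = c := by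
  obtain ⟨c, rfl⟩ := (Localization.Construction.objEquiv W).surjective c
  obtain ⟨n, i, rfl⟩ := D.exists_fromBd_eq c
  exact ⟨n, i, rfl⟩

variable {W}

/-- Maps of the homotopy category which are not identities lower the degree. -/
theorem hoDegree_lt_or_eq_eqToHom (h : ∀ (n : D.N) (i : D.bd n), D.RestrictsToInitial W i)
    {c d : W.Localization} (k : c ⟶ d) :
    D.hoDegree W d < D.hoDegree W c ∨ ∃ h : c = d, k = eqToHom h := by
  induction hm : D.hoDegree W c using Nat.strong_induction_on generalizing c with
  | _ m ih =>
    subst hm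
    by_cases hk : Under.mk k = Under.mk (𝟙 c)
    · exact Or.inr (exists_eq_eqToHom_of_eq_mk_id hk)
    · left
      obtain ⟨n, i, rfl⟩ := D.exists_hoObj_eq W c
      obtain ⟨hi, hi'⟩ := h n i
      let F := ObjectProperty.lift (fun X : Under (D.hoObj W i) => X ≠ Under.mk (𝟙 _))
        (D.toHoUnder W i) hi
      have : F.Initial := hi'
      let X : Boundary (D.hoObj W i) := ⟨Under.mk k, hk⟩
      -- By initiality `k` factors through the image of some `x` in `i/I_{<n}`, which has lower
      -- degree. The induction hypothesis for the second factor `l` then shows that the target of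
      -- `k` has lower degree too.
      let x : D.LowerSlice i := Functor.Initial.lift F X
      let l : (D.fromInterior n ⋙ W.Q).obj x.1 ⟶ d :=
        (Functor.Initial.homToLift F X).hom.right
      have hx : D.hoDegree W ((D.fromInterior n ⋙ W.Q).obj x.1) < D.hoDegree W (D.hoObj W i) :=
        degree_lowerSlice_lt x
      rcases ih _ hx l rfl with hl | ⟨e, -⟩
      · exact hl.trans hx
      · exact (congrArg (D.hoDegree W) e).symm.trans_lt hx

/-- Stated as an equality of predicates, so that limits and initiality for `(c/Ho)°` transport to
the lower slice. -/
theorem ne_mk_id_eq_hoDegree_lt (h : ∀ (n : D.N) (i : D.bd n), D.RestrictsToInitial W i)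
    (c : W.Localization) :
    (fun X : Under c => X ≠ Under.mk (𝟙 c)) =
      fun X : Under c => D.hoDegree W X.right < D.hoDegree W c := by
  funext X
  refine propext ⟨fun hX => ?_, fun hX e => ?_⟩
  · refine (D.hoDegree_lt_or_eq_eqToHom h X.hom).resolve_right fun ⟨e, e'⟩ => hX ?_
    exact mk_eq_mk_id_of_eq_eqToHom e e'
  · exact hX.ne (congrArg (fun X : Under c => D.hoDegree W X.right) e)

theorem degreeCompatible (h : ∀ (n : D.N) (i : D.bd n), D.RestrictsToInitial W i)
    {E : Type u₁} [Category.{v₁} E] {B A : W.Localization ⥤ E} (f : B ⟶ A) :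
    DegreeCompatible (D.hoDegree W) f := by
  intro c d k
  refine (D.hoDegree_lt_or_eq_eqToHom h k).imp_right ?_
  rintro ⟨rfl, rfl⟩
  exact ⟨rfl, inferInstance, inferInstance⟩

theorem hasLimitsOfShape_lower_hoDegree
    (h : ∀ (n : D.N) (i : D.bd n), D.RestrictsToInitial W i) {E : Type u₁} [Category.{v₁} E]
    [∀ (n : D.N) (i : D.bd n), HasLimitsOfShape (Boundary (D.hoObj W i)) E]
    (c : W.Localization) : HasLimitsOfShape (Lower (D.hoDegree W) c) E := by
  obtain ⟨n, i, rfl⟩ := D.exists_hoObj_eq W c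
  have key : ∀ (P P' : ObjectProperty (Under (D.hoObj W i))) (_ : P = P'),
      HasLimitsOfShape P.FullSubcategory E → HasLimitsOfShape P'.FullSubcategory E := by
    rintro P _ rfl hP
    exact hP
  exact key _ _ (D.ne_mk_id_eq_hoDegree_lt h _) inferInstance

theorem hasLimitsOfShape_lower_degree {E : Type u₁} [Category.{v₁} E]
    [∀ (n : D.N) (i : D.bd n), HasLimitsOfShape (D.LowerSlice i) E] (c : D.total) :
    HasLimitsOfShape (Lower D.degree c) E := by
  obtain ⟨n, i, rfl⟩ := D.exists_fromBd_eq c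
  exact hasLimitsOfShape_of_equivalence (D.lowerSliceFunctor i).asEquivalence

/-- The assumed initial functor is the equivalence from `i/I_{<n}` to the lower slice, followed by
the functor in question; the equivalence can be cancelled. -/
theorem initial_along_Q (h : ∀ (n : D.N) (i : D.bd n), D.RestrictsToInitial W i) (c : D.total) :
    (Lower.along W.Q (D.hoDegree W) c).Initial := by
  obtain ⟨n, i, rfl⟩ := D.exists_fromBd_eq c
  have key : ∀ (P P' : ObjectProperty (Under (D.hoObj W i))) (_ : P = P')
      (hP : ∀ x, P ((D.toHoUnder W i).obj x)), (P.lift (D.toHoUnder W i) hP).Initial →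
      ∃ hP' : ∀ x, P' ((D.toHoUnder W i).obj x), (P'.lift (D.toHoUnder W i) hP').Initial := by
    rintro P _ rfl hP hi
    exact ⟨hP, hi⟩
  obtain ⟨hi, hi'⟩ := h n i
  obtain ⟨hP, hP'⟩ := key _ _ (D.ne_mk_id_eq_hoDegree_lt h _) hi hi'
  let F : Lower D.degree ((D.fromBd n).obj i) ⥤ Lower (D.hoDegree W) (D.hoObj W i) :=
    Lower.along W.Q (D.hoDegree W) ((D.fromBd n).obj i)
  have e : D.lowerSliceFunctor i ⋙ F = ObjectProperty.lift _ (D.toHoUnder W i) hP := rfl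
  have : (D.lowerSliceFunctor i ⋙ F).Initial := e ▸ hP'
  exact Functor.initial_of_equivalence_comp (D.lowerSliceFunctor i) F

end IteratedGluingDiagram

end GluingPi

end

/-! ### The main theorem -/

theorem mainTheorem1
    (D : GluingPi.IteratedGluingDiagram.{u}) (W : MorphismProperty D.total)
    {E : Type u₁} [Category.{v₁} E] [HasPullbacks E]
    [∀ (n : D.N) (i : D.bd n), HasLimitsOfShape (D.LowerSlice i) E]
    [∀ (n : D.N) (i : D.bd n), HasLimitsOfShape (GluingPi.Boundary (D.hoObj W i)) E]
    (hepi : ∀ {X Y : W.Localization} (k : X ⟶ Y), Epi k)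
    (hinitial : ∀ (n : D.N) (i : D.bd n), D.RestrictsToInitial W i)
    {B A : W.Localization ⥤ E} (f : B ⟶ A)
    (hbd : ∀ n : D.N, GluingPi.IsPowerful (Functor.whiskerLeft (D.fromBd n ⋙ W.Q) f))
    (hmatching : ∀ n : D.N, GluingPi.IsPowerful
      ((GluingPi.matching (D.attach n) E).map (Functor.whiskerLeft (D.fromInterior n ⋙ W.Q) f)))
    (happ : ∀ (n : D.N) (i : D.bd n), GluingPi.IsPowerful (f.app (D.hoObj W i)))
    (hlocal : ∀ (n : D.N) (i : D.bd n),
      GluingPi.IsPowerful ((GluingPi.localMatching (D.hoObj W i) E).map f)) :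
    GluingPi.IsPowerful f ∧
    GluingPi.IsPowerful (((Functor.whiskeringLeft _ _ E).obj W.Q).map f) ∧
    ∀ (P : Over B ⥤ Over A) (adj : Over.pullback f ⊣ P)
      (P' : Over (W.Q ⋙ B) ⥤ Over (W.Q ⋙ A))
      (adj' : Over.pullback (((Functor.whiskeringLeft _ _ E).obj W.Q).map f) ⊣ P'),
      IsIso (GluingPi.piComparison ((Functor.whiskeringLeft _ _ E).obj W.Q) f adj adj') := by
  have : ∀ c, HasLimitsOfShape (GluingPi.Lower (D.hoDegree W) c) E :=
    D.hasLimitsOfShape_lower_hoDegree hinitial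
  -- The localisation is the identity on objects, so `D.hoDegree W ∘ W.Q.obj` is `D.degree` by
  -- definition.
  have : ∀ c, HasLimitsOfShape (GluingPi.Lower (D.hoDegree W ∘ W.Q.obj) c) E :=
    D.hasLimitsOfShape_lower_degree
  refine GluingPi.isPowerful_and_isIso_piComparison W.Q f (D.degreeCompatible hinitial f)
    (D.initial_along_Q hinitial) fun c => ?_
  obtain ⟨n, i, rfl⟩ := D.exists_hoObj_eq W c
  exact happ n i
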